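/- Identify the Euclidean plane with $\mathbb{C}$; a direction is a point of the unit circle. For a finite set $U$ of pairwise non-parallel directions, a non-degenerate convex polygon $P$ is a $U$-polygon if, for every vertex $v$ of $P$ and every $u\in U$, the line through $v$ in direction $u$ contains another vertex of $P$. For $0<c\le\operatorname{card}(U)$, a $U$-polygon $P$ is of class $c$ if $c$ is the largest integer not exceeding $\operatorname{card}(U)$ such that $P$ has $c$ consecutive edges each of which is parallel to an element of $U$. A polygon in $\Lambda\subset\mathbb{C}$ is a polygon with all its vertices in $\Lambda$. For $n\ge 3$ let $\zeta_n=e^{2\pi i/n}$ and $\mathcal{O}_n=\mathbb{Z}[\zeta_n]$. A cyclotomic model set with underlying module $\mathcal{O}_n$ is any set of the form $$\Lambda=t+\{z\in\mathcal{O}_n : (\sigma_2(z),\dots,\sigma_{\phi(n)/2}(z))\in W\},$$ where $t\in\mathbb{C}$, the automorphisms $\sigma_2,\dots,\sigma_{\phi(n)/2}$ of $\mathbb{Q}(\zeta_n)$ are obtained by choosing exactly one from each pair of complex conjugate automorphisms other than the pair consisting of the identity and complex conjugation, and $W\subset\mathbb{C}^{\phi(n)/2-1}$ has non-empty interior and compact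 closure. Let $m\ge 8$ be even, let $n\ge 3$, and let $\Lambda$ be a cyclotomic model set with underlying module $\mathcal{O}_n$. (a) If $n\in\{3,4\}$, then there exist a finite set $U$ of pairwise non-parallel directions and a $U$-polygon in $\Lambda$ of some class $c\ge 4$ with exactly $m$ edges if and only if $m\in\{8,12\}$. (b) If $n\in\{8,9,12\}$, or if $n=2p+1$ where $p$ and $2p+1$ are both prime, then there exist a finite set $U$ of pairwise non-parallel directions and a $U$-polygon in $\Lambda$ of some class $c\ge 4$ with exactly $m$ edges if and only if $$\begin{cases} m\in\{8,12,2n\}, & \text{if } n=8 \text{ or } n=12,\\ m\in\{8,12,2n,4n\}, & \text{otherwise.}\end{cases}$$ -/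

import Mathlib

noncomputable section

namespace UPoly

/-! ### Plane geometry, with the Euclidean plane identified with the complex numbers -/

/-- The determinant of two vectors of the plane. It is positive exactly when `b` points strictly to
the left of `a`. -/
def cross (a b : ℂ) : ℝ := a.re * b.im - a.im * b.re

/-- Parallelism of two (nonzero) vectors of the plane. -/
def Parallel (a b : ℂ) : Prop := cross a b = 0

/-- `v` lists the vertices of a non-degenerate convex polygon with exactly `m` edges in
counterclockwise order, indices being read modulo `m`: every vertex other than the two end points
of the edge from `v i` to `v (i + 1)` lies strictly to the left of the line carrying that edge.
The polygon itself is the convex hull of the `v i`, its vertices are the `m` distinct points `v i`,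
and its edges are the `m` segments from `v i` to `v (i + 1)`. -/
structure IsConvexPolygon (m : ℕ) (v : ZMod m → ℂ) : Prop where
  three_le : 3 ≤ m
  left_of_edge : ∀ i j : ZMod m, j ≠ i → j ≠ i + 1 → 0 < cross (v (i + 1) - v i) (v j - v i)

/-- `U` is a (finite) set of pairwise non-parallel directions; directions are the points of the
unit circle. -/
def PairwiseNonparallel (U : Finset Circle) : Prop :=
  ∀ u ∈ U, ∀ w ∈ U, u ≠ w → ¬ Parallel (u : ℂ) (w : ℂ)

/-- The polygon with vertices `v` is a `U`-polygon: it is a non-degenerate convex polygon, the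
directions in `U` are pairwise non-parallel, and each line in a direction of `U` through a vertex
passes through another vertex. -/
structure IsUPolygon (U : Finset Circle) (m : ℕ) (v : ZMod m → ℂ) : Prop where
  convex : IsConvexPolygon m v
  nonparallel : PairwiseNonparallel U
  line_meets : ∀ i : ZMod m, ∀ u ∈ U, ∃ j : ZMod m, j ≠ i ∧ ∃ t : ℝ, v j = v i + (t : ℂ) * (u : ℂ)

/-- There are `k` consecutive edges of the polygon all of whose directions belong to `U`
(that is, each of these edges is parallel to an element of `U`). -/
def HasConsecutiveEdges (U : Finset Circle) (m : ℕ) (v : ZMod m → ℂ) (k : ℕ) : Prop :=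
  k ≤ m ∧ ∃ i : ZMod m, ∀ j : ℕ, j < k →
    ∃ u ∈ U, Parallel (u : ℂ) (v (i + (j : ZMod m) + 1) - v (i + (j : ZMod m)))

/-- The polygon with vertices `v` is a `U`-polygon of class `c` with respect to `U`, where
`0 < c ≤ card U`: the number `c` is maximal among the numbers up to `card U` of consecutive edges
whose directions belong to `U`. (The bound `card U` matters only if all edges have directions in
`U`; then the class is `card U`, which is half the number of edges.) -/
structure IsUPolygonOfClass (U : Finset Circle) (c m : ℕ) (v : ZMod m → ℂ) : Prop where
  isUPolygon : IsUPolygon U m v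
  pos : 0 < c
  isGreatest : IsGreatest {k : ℕ | k ≤ U.card ∧ HasConsecutiveEdges U m v k} c

/-- There is a `U`-polygon of class `c ≥ 4` with `m` edges and with all its vertices in `Λ`, for
some finite set `U` of pairwise non-parallel directions. -/
def ExistsUPolygonOfClassGeFour (Λ : Set ℂ) (m : ℕ) : Prop :=
  ∃ (U : Finset Circle) (c : ℕ) (v : ZMod m → ℂ),
    4 ≤ c ∧ IsUPolygonOfClass U c m v ∧ ∀ i : ZMod m, v i ∈ Λ

/-! ### Cyclotomic model sets -/

/-- The primitive `n`-th root of unity `exp (2 π i / n)`. -/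
def zeta (n : ℕ) : ℂ := Complex.exp (2 * Real.pi * Complex.I / n)

/-- The `n`-th cyclotomic field `ℚ(ζ_n)` inside the complex numbers. -/
def cycField (n : ℕ) : IntermediateField ℚ ℂ := IntermediateField.adjoin ℚ {zeta n}

/-- The ring `ℤ[ζ_n]` inside the complex numbers. -/
def cycRing (n : ℕ) : Subalgebra ℤ ℂ := Algebra.adjoin ℤ {zeta n}

/-- The complex numbers underlying `σ z` and `τ z` are conjugate for all `z`, that is,
`σ` is `τ` followed by complex conjugation. -/
def ConjugateAut {n : ℕ} (σ τ : cycField n ≃ₐ[ℚ] cycField n) : Prop :=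
  ∀ z : cycField n, (σ z : ℂ) = (starRingEnd ℂ) (τ z : ℂ)

/-- The family `σ` lists, without repetition, automorphisms of `ℚ(ζ_n)` other than the identity and
complex conjugation, exactly one from each pair of complex conjugate ones. -/
structure IsStarFamily (n : ℕ)
    (σ : Fin (Nat.totient n / 2 - 1) → (cycField n ≃ₐ[ℚ] cycField n)) : Prop where
  ne_id : ∀ j, σ j ≠ AlgEquiv.refl
  ne_conj : ∀ j, ¬ ConjugateAut (σ j) AlgEquiv.refl
  exactly_one : ∀ τ : cycField n ≃ₐ[ℚ] cycField n,
    τ ≠ AlgEquiv.refl → ¬ ConjugateAut τ AlgEquiv.refl →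
      ∃! j, σ j = τ ∨ ConjugateAut (σ j) τ

/-- The star map attached to a family of automorphisms. -/
def starMap {n : ℕ} (σ : Fin (Nat.totient n / 2 - 1) → (cycField n ≃ₐ[ℚ] cycField n))
    (z : cycField n) : Fin (Nat.totient n / 2 - 1) → ℂ :=
  fun j => (σ j z : ℂ)

/-- `Λ` is a cyclotomic model set with underlying `ℤ`-module `ℤ[ζ_n]`: a translate of the set of
those `z ∈ ℤ[ζ_n]` whose star image lies in a window `W` with non-empty interior and compact
closure. -/
def IsCyclotomicModelSet (n : ℕ) (Λ : Set ℂ) : Prop :=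
  3 ≤ n ∧
  ∃ (σ : Fin (Nat.totient n / 2 - 1) → (cycField n ≃ₐ[ℚ] cycField n))
    (W : Set (Fin (Nat.totient n / 2 - 1) → ℂ)) (t : ℂ),
    IsStarFamily n σ ∧ (interior W).Nonempty ∧ IsCompact (closure W) ∧
    Λ = {x : ℂ | ∃ z : cycField n, (z : ℂ) ∈ cycRing n ∧ starMap σ z ∈ W ∧ x = t + (z : ℂ)}

/-- `p` is a Sophie Germain prime. -/
def IsSophieGermain (p : ℕ) : Prop := p.Prime ∧ (2 * p + 1).Prime

end UPoly

end

namespace UPoly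

/-! ### The determinant of two vectors -/

/-! Write m = 2k. The theorem reduces to deciding which k ≥ 4 are possible, and what decides this is
whether 2 cos(2πj/k), for some j prime to k, lies in ℚ(ζ_n).

Necessity. In a convex polygon an edge direction u ∈ U pairs the vertices on common u-lines, and
convexity forces the pairing to be the index reflection exchanging the ends of that edge
(`IsUPolygon.cross_reflect`). Four consecutive edges thus give four linear functionals on the plane,
symmetric along the vertex sequence about centers in arithmetic progression. Any three functionals
on a plane are linearly dependent, and eliminating with these dependencies yields v(i+2) + v(i-2) =
l v(i) + C with l real (`exists_recurrence`). The even-indexed vertices have exact period k, so l =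
a + a⁻¹ for a primitive k-th root of unity a, while l is also a quotient of vertex differences and
so lies in ℚ(ζ_n). Galois theory turns a + a⁻¹ ∈ ℚ(ζ_n) into a condition on units modulo k
(`dvd_sub_one_or_dvd_add_one`), and comparing totients leaves k = 4, k = 6, k ∣ n, or k = 2g with g
an odd divisor of n (`order_of_trace_mem_cycField`). For the listed n this is a finite check.

Existence. The orbit of 2 + ζ_k under the dihedral group of order 2k is a 2k-gon all of whose edges
have directions in a set of k directions. Nonsingular affine maps preserve this property. If ℤ[ζ_k]
⊆ ℤ[ζ_n], the orbit consists of cyclotomic integers; for k = 4, 6 the lattice ℤ[ζ_k] has rank 2 and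
is carried into ℤ[ζ_n] by a real-linear map for every n ≥ 3. Finally every model set contains a
homothetic copy of each finite subset of ℤ[ζ_n] (`IsCyclotomicModelSet.exists_homothety`), by
density of the star image and a contracting unit. -/

lemma cross_self (a : ℂ) : cross a a = 0 := by unfold cross; ring

lemma cross_comm (a b : ℂ) : cross a b = -cross b a := by unfold cross; ring

lemma cross_add_right (a b c : ℂ) : cross a (b + c) = cross a b + cross a c := by
  simp only [cross, Complex.add_re, Complex.add_im]; ring

lemma cross_sub_right (a b c : ℂ) : cross a (b - c) = cross a b - cross a c := by
  simp only [cross, Complex.sub_re, Complex.sub_im]; ring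

lemma cross_ofReal_mul_right (a b : ℂ) (t : ℝ) : cross a ((t : ℂ) * b) = t * cross a b := by
  simp only [cross, Complex.re_ofReal_mul, Complex.im_ofReal_mul]; ring

lemma cross_ofReal_mul_left (a b : ℂ) (t : ℝ) : cross ((t : ℂ) * a) b = t * cross a b := by
  simp only [cross, Complex.re_ofReal_mul, Complex.im_ofReal_mul]; ring

/-- A vector parallel to a nonzero vector is a real multiple of it. -/
lemma exists_eq_ofReal_mul_of_cross_eq_zero {u z : ℂ} (hu : u ≠ 0) (h : cross u z = 0) :
    ∃ t : ℝ, z = (t : ℂ) * u := by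
  have hn : u.re ^ 2 + u.im ^ 2 ≠ 0 := fun h0 => hu <| Complex.ext
    (by simpa using (pow_eq_zero_iff two_ne_zero).1 (by nlinarith [sq_nonneg u.re, sq_nonneg u.im]
      : u.re ^ 2 = 0))
    (by simpa using (pow_eq_zero_iff two_ne_zero).1 (by nlinarith [sq_nonneg u.re, sq_nonneg u.im]
      : u.im ^ 2 = 0))
  refine ⟨(z.re * u.re + z.im * u.im) / (u.re ^ 2 + u.im ^ 2), Complex.ext ?_ ?_⟩
  · rw [Complex.re_ofReal_mul, div_mul_eq_mul_div, eq_div_iff hn]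
    unfold cross at h
    linear_combination -u.im * h
  · rw [Complex.im_ofReal_mul, div_mul_eq_mul_div, eq_div_iff hn]
    unfold cross at h
    linear_combination u.re * h

lemma cross_eq_zero_of_parallel {u a b : ℂ} (hu : u ≠ 0) (ha : cross u a = 0)
    (hb : cross u b = 0) : cross a b = 0 := by
  obtain ⟨s, rfl⟩ := exists_eq_ofReal_mul_of_cross_eq_zero hu ha
  obtain ⟨t, rfl⟩ := exists_eq_ofReal_mul_of_cross_eq_zero hu hb
  rw [cross_ofReal_mul_left, cross_ofReal_mul_right, cross_self]; simp

/-- Two functionals with independent directions separate points. -/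
lemma eq_zero_of_cross_eq_zero {p q z : ℂ} (hpq : cross p q ≠ 0) (hp : cross p z = 0)
    (hq : cross q z = 0) : z = 0 := by
  unfold cross at *
  refine Complex.ext ?_ ?_
  · exact (mul_eq_zero.1 (by linear_combination q.re * hp - p.re * hq :
      (p.re * q.im - p.im * q.re) * z.re = 0)).resolve_left hpq
  · exact (mul_eq_zero.1 (by linear_combination q.im * hp - p.im * hq :
      (p.re * q.im - p.im * q.re) * z.im = 0)).resolve_left hpq

/-- The explicit dependence among three functionals on a two-dimensional space; it drives the
elimination behind the recurrence. -/
lemma cross_jacobi (a b c z : ℂ) :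
    cross b c * cross a z + cross c a * cross b z + cross a b * cross c z = 0 := by
  unfold cross; ring

/-! ### Convex polygons, with the vertices indexed by the integers -/

lemma zmod_intCast_ne {m : ℕ} {a b : ℤ} (h1 : a < b) (h2 : b < a + m) :
    (a : ZMod m) ≠ (b : ZMod m) := by
  intro h
  rw [ZMod.intCast_eq_intCast_iff_dvd_sub] at h
  have := Int.le_of_dvd (by omega) h
  omega

/-- Any three vertices of a convex polygon are in counterclockwise position. -/
lemma IsConvexPolygon.cross_pos {m : ℕ} {v : ZMod m → ℂ} (hv : IsConvexPolygon m v) {a b c : ℤ}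
    (hab : a < b) (hbc : b < c) (hca : c < a + m) :
    0 < cross (v b - v a) (v c - v a) := by
  have edge : ∀ b : ℤ, a < b → b + 1 < a + m →
      0 < cross (v b - v a) (v (b + 1 : ℤ) - v a) := by
    intro b h1 h2
    have := hv.left_of_edge (b : ZMod m) (a : ZMod m) (zmod_intCast_ne h1 (by omega))
      (by have := zmod_intCast_ne (m := m) (a := a) (b := b + 1) (by omega) h2
          simpa using this)
    push_cast
    unfold cross at *
    simp only [Complex.sub_re, Complex.sub_im] at *
    linarith
  have first : ∀ c : ℤ, a + 1 < c → c < a + m →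
      0 < cross (v (a + 1 : ℤ) - v a) (v c - v a) := by
    intro c h1 h2
    have := hv.left_of_edge (a : ZMod m) (c : ZMod m) (zmod_intCast_ne (by omega) h2).symm
      (by have := zmod_intCast_ne (m := m) (a := a + 1) (b := c) (by omega) (by omega)
          simpa using this.symm)
    simpa using this
  rcases eq_or_lt_of_le (show a + 1 ≤ b by omega) with rfl | hb
  · exact first c hbc hca
  · induction c, (show b + 1 ≤ c by omega) using Int.leInduction with
    | base => exact edge b hab hca
    | succ c hc ih =>
      have h1 := first b hb (by omega)
      have h2 := first c (by omega) (by omega)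
      have h3 := first (c + 1) (by omega) hca
      have h4 := edge c (by omega) hca
      have h5 := ih (by omega) (by omega)
      -- Three-term Plücker relation for the vectors from `v a` to `v (a + 1)`, `v b`, `v c`, `v (c
      -- + 1)`; every other determinant in it is already known to be positive.
      have key : cross (v (a + 1 : ℤ) - v a) (v c - v a)
            * cross (v b - v a) (v (c + 1 : ℤ) - v a)
          = cross (v (a + 1 : ℤ) - v a) (v b - v a) * cross (v c - v a) (v (c + 1 : ℤ) - v a)
          + cross (v (a + 1 : ℤ) - v a) (v (c + 1 : ℤ) - v a)
            * cross (v b - v a) (v c - v a) := by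
        unfold cross; ring
      exact (mul_pos_iff_of_pos_left h2).1 (key ▸ by positivity)

/-- Points in counterclockwise position are the vertices of a convex polygon. -/
lemma isConvexPolygon_of_cross_pos {m : ℕ} (hm : 3 ≤ m) {v : ZMod m → ℂ}
    (h : ∀ a b c : ℤ, a < b → b < c → c < a + m → 0 < cross (v b - v a) (v c - v a)) :
    IsConvexPolygon m v := by
  have : NeZero m := ⟨by omega⟩
  refine ⟨hm, fun i j h1 h2 => ?_⟩
  obtain ⟨a, rfl⟩ := ZMod.intCast_surjective i
  obtain ⟨d, hd, rfl⟩ : ∃ d : ℕ, d < m ∧ j = (a : ZMod m) + d :=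
    ⟨(j - a).val, ZMod.val_lt _, by simp⟩
  have hd0 : d ≠ 0 := by rintro rfl; simp at h1
  have hd1 : d ≠ 1 := by rintro rfl; simp at h2
  have := h a (a + 1) (a + d) (by omega) (by omega) (by omega)
  simpa using this

lemma IsConvexPolygon.injective {m : ℕ} {v : ZMod m → ℂ} (hv : IsConvexPolygon m v) :
    Function.Injective v := by
  have : NeZero m := ⟨by have := hv.three_le; omega⟩
  intro i j hij
  by_contra hne
  by_cases h : i = j + 1
  · have h3 := hv.left_of_edge j (j + 2)
      (fun h' => by
        have := zmod_intCast_ne (m := m) (a := 0) (b := 2) (by omega)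
          (by have := hv.three_le; omega)
        exact this (by simpa using Eq.symm (by simpa using h' : (2 : ZMod m) = 0)))
      (fun h' => by
        have := zmod_intCast_ne (m := m) (a := 1) (b := 2) (by omega)
          (by have := hv.three_le; omega)
        exact this (by simpa using h'.symm))
    rw [← h, hij] at h3
    simp [cross] at h3
  · have h3 := hv.left_of_edge j i hne h
    rw [hij] at h3
    simp [cross] at h3

/-- A line contains at most two vertices of a convex polygon. -/
lemma IsConvexPolygon.not_three_collinear {m : ℕ} {v : ZMod m → ℂ} (hv : IsConvexPolygon m v)
    {u : ℂ} (hu : u ≠ 0) {i j k : ZMod m} (hij : i ≠ j) (hik : i ≠ k) (hjk : j ≠ k)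
    (h1 : cross u (v i) = cross u (v j)) (h2 : cross u (v i) = cross u (v k)) : False := by
  have : NeZero m := ⟨by have := hv.three_le; omega⟩
  obtain ⟨a, rfl⟩ := ZMod.intCast_surjective i
  obtain ⟨d, hd, rfl⟩ : ∃ d : ℕ, d < m ∧ j = (a : ZMod m) + d :=
    ⟨(j - a).val, ZMod.val_lt _, by simp⟩
  obtain ⟨e, he, rfl⟩ : ∃ d : ℕ, d < m ∧ k = (a : ZMod m) + d :=
    ⟨(k - a).val, ZMod.val_lt _, by simp⟩
  have hd0 : d ≠ 0 := by rintro rfl; simp at hij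
  have he0 : e ≠ 0 := by rintro rfl; simp at hik
  have hde : d ≠ e := by rintro rfl; simp at hjk
  have h0 : cross (v (a + d) - v a) (v (a + e) - v a) = 0 :=
    cross_eq_zero_of_parallel hu (by rw [cross_sub_right, h1, sub_self])
      (by rw [cross_sub_right, h2, sub_self])
  rcases lt_or_gt_of_ne hde with h | h
  · have := hv.cross_pos (a := a) (b := a + d) (c := a + e) (by omega) (by omega) (by omega)
    push_cast at this
    exact this.ne' h0
  · have := hv.cross_pos (a := a) (b := a + e) (c := a + d) (by omega) (by omega) (by omega)
    push_cast at this
    rw [cross_comm] at this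
    linarith

/-! ### Pairing of the vertices by a direction -/

lemma IsUPolygon.exists_partner {U : Finset Circle} {m : ℕ} {v : ZMod m → ℂ}
    (hP : IsUPolygon U m v) {u : Circle} (hu : u ∈ U) (x : ℤ) :
    ∃ p : ℤ, x < p ∧ p < x + m ∧ ∃ t : ℝ, v p - v x = (t : ℂ) * (u : ℂ) := by
  have : NeZero m := ⟨by have := hP.convex.three_le; omega⟩
  obtain ⟨j, hj, t, ht⟩ := hP.line_meets x u hu
  obtain ⟨d, hd, rfl⟩ : ∃ d : ℕ, d < m ∧ j = (x : ZMod m) + d :=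
    ⟨(j - x).val, ZMod.val_lt _, by simp⟩
  have hd0 : d ≠ 0 := by rintro rfl; simp at hj
  refine ⟨x + d, by omega, by omega, t, ?_⟩
  push_cast
  rw [ht]; ring

/-- A direction of `U` carried by the edge from `v a` to `v (a + 1)` pairs the vertices by the
reflection of the index set which exchanges `a` and `a + 1`. -/
lemma IsUPolygon.cross_reflect {U : Finset Circle} {m k : ℕ} {v : ZMod m → ℂ}
    (hP : IsUPolygon U m v) (hmk : m = 2 * k) {u : Circle} (hu : u ∈ U) {a : ℤ}
    (ha : cross u (v (a + 1 : ℤ)) = cross u (v a)) (i : ℤ) :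
    cross u (v (2 * a + 1 - i : ℤ)) = cross u (v i) := by
  have hu0 : (u : ℂ) ≠ 0 := Circle.coe_ne_zero u
  have hper : ∀ x : ℤ, v (x + m : ℤ) = v x := fun x => by simp
  have hper' : ∀ x : ℤ, v (x - m : ℤ) = v x := fun x => by simp
  have hv := hP.convex
  have hm3 := hv.three_le
  have chord : ∀ {x p y : ℤ} {t : ℝ}, v p - v x = (t : ℂ) * (u : ℂ) → x < p → p < y → y < x + m →
      0 < t * (cross u (v y) - cross u (v x)) := by
    intro x p y t ht h1 h2 h3
    have := hv.cross_pos h1 h2 h3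
    rwa [ht, cross_ofReal_mul_left, cross_sub_right] at this
  have level : ∀ {x p : ℤ} {t : ℝ}, v p - v x = (t : ℂ) * (u : ℂ) →
      cross u (v p) = cross u (v x) := by
    intro x p t ht
    rw [← sub_eq_zero, ← cross_sub_right, ht, cross_ofReal_mul_right, cross_self, mul_zero]
  have three : ∀ {x y z : ℤ}, x < y → y < z → z < x + m → cross u (v x) = cross u (v y) →
      cross u (v x) = cross u (v z) → False := by
    intro x y z h1 h2 h3
    exact hv.not_three_collinear hu0 (zmod_intCast_ne h1 (by omega)) (zmod_intCast_ne (by omega) h3)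
      (zmod_intCast_ne h2 (by omega))
  obtain ⟨s, hs⟩ := exists_eq_ofReal_mul_of_cross_eq_zero hu0
    (show cross u (v (a + 1 : ℤ) - v a) = 0 by rw [cross_sub_right, ha, sub_self])
  have core : ∀ j : ℕ, j < k → cross u (v (a + 1 + j : ℤ)) = cross u (v (a - j : ℤ)) := by
    intro j
    induction j using Nat.strong_induction_on with
    | _ j ih =>
    intro hj
    rcases Nat.eq_zero_or_pos j with rfl | hj0
    · simpa using ha
    -- The vertices strictly between `a - j` and `a + 1 + j` are already paired among themselves; a
    -- further vertex on one of their lines would be a third collinear one.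
    have inner : ∀ z : ℤ, a - j < z → z < a + 1 + j → (∀ y : ℤ, a + 1 + j ≤ y → y ≤ a - j + m →
        cross u (v y) = cross u (v z) → False) := by
      intro z h1 h2 y h3 h4 h5
      rcases le_or_gt z a with hz | hz
      · obtain ⟨l, rfl⟩ : ∃ l : ℕ, z = a - l := ⟨(a - z).toNat, by omega⟩
        have := ih l (by omega) (by omega)
        exact three (x := a - l) (y := a + 1 + l) (z := y) (by omega) (by omega) (by omega)
          this.symm h5.symm
      · obtain ⟨l, rfl⟩ : ∃ l : ℕ, z = a + 1 + l := ⟨(z - a - 1).toNat, by omega⟩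
        have := ih l (by omega) (by omega)
        exact three (x := a - l) (y := a + 1 + l) (z := y) (by omega) (by omega) (by omega)
          this.symm (h5.trans this).symm
    by_contra hne
    obtain ⟨p, hp1, hp2, t, ht⟩ := hP.exists_partner hu (a + 1 + j)
    obtain ⟨q, hq1, hq2, t', ht'⟩ := hP.exists_partner hu (a - j)
    have hp : p < a - j + m := by
      by_contra hp
      rcases eq_or_lt_of_le (not_lt.1 hp) with h | h
      · apply hne
        rw [← level ht, ← h, hper]
      · refine inner (p - m) (by omega) (by omega) (a + 1 + j) le_rfl (by omega) ?_
        rw [hper', level ht]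
    have hq : a + 1 + j < q := by
      by_contra hq
      rcases eq_or_lt_of_le (not_lt.1 hq) with h | h
      · exact hne (by rw [← level ht', h])
      · refine inner q (by omega) (by omega) (a - j + m) (by omega) le_rfl ?_
        rw [hper, level ht']
    have e1 := chord (y := a - j + m) ht (by omega) hp (by omega)
    have e2 := chord (y := a + m) ht (by omega) (by omega) (by omega)
    have ht2 : v (a - j + m : ℤ) - v q = ((-t' : ℝ) : ℂ) * (u : ℂ) := by
      rw [hper, Complex.ofReal_neg, neg_mul, ← ht', neg_sub]
    have e3 := chord (y := a + m) ht2 (by omega) (by omega) (by omega)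
    have e4 := chord (y := a + 1 + j + m) ht2 (by omega) (by omega) (by omega)
    have e5 := chord (y := a + 1 + j) hs (by omega) (by omega) (by omega)
    have e6 := chord (y := a - j + m) hs (by omega) (by omega) (by omega)
    rw [hper] at e1 e2 e3 e4 e6
    rw [level ht'] at e3 e4
    set A := cross u (v a)
    set X := cross u (v (a + 1 + j : ℤ))
    set Y := cross u (v (a - j : ℤ))
    -- Each chord in direction `u` has the other vertices concerned on one side. Hence none of the
    -- levels `A`, `X`, `Y` lies between the other two, which is impossible for three reals.
    have f1 : 0 < (Y - X) * (A - X) := by nlinarith [mul_pos e1 e2, sq_nonneg t]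
    have f2 : 0 < (A - Y) * (X - Y) := by nlinarith [mul_pos e3 e4, sq_nonneg t']
    have f3 : 0 < (X - A) * (Y - A) := by nlinarith [mul_pos e5 e6, sq_nonneg s]
    nlinarith [mul_pos f1 f2, mul_nonneg f3.le (sq_nonneg (X - Y))]
  obtain ⟨c, e, he, rfl⟩ : ∃ (c : ℤ) (e : ℕ), e < m ∧ i = a + 1 + e + m * c := by
    refine ⟨(i - (a + 1)) / m, ((i - (a + 1)) % m).toNat, ?_, ?_⟩
    · have := Int.emod_lt_of_pos (i - (a + 1)) (show (0 : ℤ) < m by omega)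
      omega
    · have := Int.emod_nonneg (i - (a + 1)) (show (m : ℤ) ≠ 0 by omega)
      have h2 := Int.emod_add_mul_ediv (i - (a + 1)) m
      rw [Int.toNat_of_nonneg this]
      linarith
  have r1 : v (a + 1 + e + m * c : ℤ) = v (a + 1 + e : ℤ) := by simp
  have r2 : v (2 * a + 1 - (a + 1 + e + m * c) : ℤ) = v (a - e : ℤ) := by
    congr 1; push_cast; simp; ring
  rw [r1, r2]
  rcases lt_or_ge e k with h | h
  · exact (core e h).symm
  · obtain ⟨j, rfl⟩ : ∃ j : ℕ, m = e + 1 + j := ⟨m - (e + 1), by omega⟩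
    have := core j (by omega)
    rw [← hper (a - e), ← hper' (a + 1 + e)]
    convert this using 4
    all_goals push_cast; ring

/-- Directions of two edges whose reflections of the index set differ are not parallel. -/
lemma IsUPolygon.cross_ne_zero {U : Finset Circle} {m k : ℕ} {v : ZMod m → ℂ}
    (hP : IsUPolygon U m v) (hmk : m = 2 * k) {u w : Circle} (hw : w ∈ U) {a b : ℤ}
    (ha : cross u (v (a + 1 : ℤ)) = cross u (v a)) (hb : cross w (v (b + 1 : ℤ)) = cross w (v b))
    (hab : a < b) (hbk : b < a + k) :
    cross (u : ℂ) (w : ℂ) ≠ 0 := by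
  intro h
  obtain ⟨t, ht⟩ := exists_eq_ofReal_mul_of_cross_eq_zero (Circle.coe_ne_zero w)
    (show cross (w : ℂ) (u : ℂ) = 0 by rw [cross_comm, h, neg_zero])
  -- If `u` and `w` were parallel, `v a` would lie on one line with its partners `a + 1` and `2 * b
  -- + 1 - a` under the two reflections.
  have h1 := hP.cross_reflect hmk hw hb a
  have h2 : cross u (v (2 * b + 1 - a : ℤ)) = cross u (v a) := by
    rw [ht, cross_ofReal_mul_left, cross_ofReal_mul_left, h1]
  exact hP.convex.not_three_collinear (Circle.coe_ne_zero u)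
    (zmod_intCast_ne (m := m) (a := a) (b := a + 1) (by omega) (by omega))
    (zmod_intCast_ne (m := m) (a := a) (b := 2 * b + 1 - a) (by omega) (by omega))
    (zmod_intCast_ne (m := m) (a := a + 1) (b := 2 * b + 1 - a) (by omega) (by omega))
    ha.symm h2.symm

/-! ### The linear recurrence satisfied by the vertices -/

/-- Three linearly dependent sequences which are symmetric about centers in arithmetic progression
are, up to constants, determined by the first one. -/
lemma exists_const_of_symmetric {x y z : ℤ → ℝ} {a b c : ℝ} {s : ℤ} (hs : Odd s)
    (hx : ∀ i, x (s - i) = x i) (hy : ∀ i, y (s + 2 - i) = y i) (hz : ∀ i, z (s + 4 - i) = z i)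
    (h : ∀ i, a * x i + b * y i + c * z i = 0) :
    ∃ C : ℝ, (∀ i, c * z i = a * x (i - 2) + C) ∧
      ∀ i, b * y i = -a * (x i + x (i - 2)) - C := by
  -- Reflecting the relation in the center of `y` leaves the `y` term fixed, so it cancels on
  -- subtraction.
  have step : ∀ i, c * z (i + 2) - a * x (i + 2 - 2) = c * z i - a * x (i - 2) := by
    intro i
    have h1 := h i
    have h2 := h (s + 2 - i)
    rw [hy, show x (s + 2 - i) = x (i - 2) by rw [← hx]; congr 1; ring,
      show z (s + 2 - i) = z (i + 2) by rw [← hz]; congr 1; ring] at h2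
    rw [add_sub_cancel_right]
    linarith
  -- By `step` the difference has period 2. The reflection `i ↦ s + 4 - i` swaps parities because
  -- `s` is odd, so the difference is constant.
  have refl : ∀ i, c * z (s + 4 - i) - a * x (s + 4 - i - 2) = c * z i - a * x (i - 2) := by
    intro i
    rw [hz, show x (s + 4 - i - 2) = x (i - 2) by rw [← hx]; congr 1; ring]
  have even : ∀ j : ℤ, c * z (2 * j) - a * x (2 * j - 2) = c * z 0 - a * x (0 - 2) := by
    intro j
    induction j using Int.induction_on with
    | zero => simp
    | succ j ih => rw [← ih, ← step (2 * j)]; ring_nf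
    | pred j ih => rw [← ih, ← step (2 * (-(j : ℤ) - 1))]; ring_nf
  have key : ∀ i, c * z i = a * x (i - 2) + (c * z 0 - a * x (0 - 2)) := by
    intro i
    rcases Int.even_or_odd' i with ⟨j, rfl | rfl⟩
    · linarith [even j]
    · obtain ⟨l, rfl⟩ := hs
      have h1 := refl (2 * j + 1)
      rw [show 2 * l + 1 + 4 - (2 * j + 1) = 2 * (l + 2 - j) by ring, even] at h1
      linarith
  exact ⟨_, key, fun i => by linarith [key i, h i]⟩

/-- If four vectors, any two consecutive or next to consecutive ones independent, give functionals
which are symmetric along `w` with centers of symmetry in arithmetic progression, then `w`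
satisfies a linear recurrence. -/
lemma exists_recurrence {w : ℤ → ℂ} {p q r t : ℂ} {s : ℤ} (hs : Odd s)
    (hp : ∀ i, cross p (w (s - i)) = cross p (w i))
    (hq : ∀ i, cross q (w (s + 2 - i)) = cross q (w i))
    (hr : ∀ i, cross r (w (s + 4 - i)) = cross r (w i))
    (ht : ∀ i, cross t (w (s + 6 - i)) = cross t (w i))
    (hpq : cross p q ≠ 0) (hqr : cross q r ≠ 0) (hpr : cross p r ≠ 0)
    (hrt : cross r t ≠ 0) :
    ∃ (l : ℝ) (C : ℂ), ∀ i, w (i + 2) + w (i - 2) = (l : ℂ) * w i + C := by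
  -- The triple `p, q, r` expresses the `q`- and `r`-values through the `p`-values; the triple `q,
  -- r, t` relates the `r`- and `q`-values once more. Substitution gives a recurrence for the
  -- `p`-values, hence for the `q`-values, and these two are coordinates of the plane.
  obtain ⟨C₁, h1, h2⟩ := exists_const_of_symmetric hs hp hq hr (fun i => cross_jacobi p q r (w i))
  obtain ⟨C₂, -, h4⟩ := exists_const_of_symmetric (s := s + 2) (Odd.add_even hs even_two) hq
    (fun i => by rw [← hr i]; congr 2; ring) (fun i => by rw [← ht i]; congr 2; ring)
    (fun i => cross_jacobi q r t (w i))
  rw [cross_comm r p] at h2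
  set a := cross q r
  set b := cross p r
  set c := cross p q
  set b' := cross t q
  set a' := cross r t
  have hx : ∀ i, cross p (w (i + 2)) + cross p (w (i - 2))
      = (-(b * b' / (a' * c)) - 2) * cross p (w i)
        - (b * b' * C₁ + 2 * a' * c * C₁ + b * c * C₂) / (a' * c * a) := by
    intro i
    have e1 := h1 (i + 2)
    have e2 := h2 (i + 2)
    have e3 := h2 i
    have e4 := h4 (i + 2)
    rw [add_sub_cancel_right] at e1 e2 e4
    field_simp
    linear_combination -b * b' * e1 + b * c * e4 + a' * c * e2 + a' * c * e3
  set l := -(b * b' / (a' * c)) - 2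
  set D := -(b * b' * C₁ + 2 * a' * c * C₁ + b * c * C₂) / (a' * c * a)
  have hy : ∀ i, cross q (w (i + 2)) + cross q (w (i - 2))
      = l * cross q (w i) + (a * 2 * D + (2 - l) * C₁) / b := by
    intro i
    have e1 := h2 (i + 2)
    have e2 := h2 i
    have e3 := h2 (i - 2)
    have e4 := hx i
    have e5 := hx (i - 2)
    rw [add_sub_cancel_right] at e1
    rw [sub_add_cancel] at e5
    field_simp
    simp only [D]
    linear_combination -e1 + l * e2 - e3 + a * e4 + a * e5
  have hz : ∀ z i, cross z (w (i + 2) + w (i - 2) - (l : ℂ) * w i)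
      = cross z (w (i + 2)) + cross z (w (i - 2)) - l * cross z (w i) := fun z i => by
    rw [cross_sub_right, cross_add_right, cross_ofReal_mul_right]
  refine ⟨l, w (0 + 2) + w (0 - 2) - (l : ℂ) * w 0, fun i => ?_⟩
  have := eq_zero_of_cross_eq_zero (z := (w (i + 2) + w (i - 2) - (l : ℂ) * w i)
      - (w (0 + 2) + w (0 - 2) - (l : ℂ) * w 0)) hpq
    (by rw [cross_sub_right, hz, hz, hx, hx]; ring)
    (by rw [cross_sub_right, hz, hz, hy, hy]; ring)
  linear_combination this

/-- The vertices of a `U`-polygon with four consecutive edges in directions of `U` satisfy a linear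
recurrence. -/
lemma IsUPolygon.exists_recurrence {U : Finset Circle} {m k : ℕ} {v : ZMod m → ℂ}
    (hP : IsUPolygon U m v) (hmk : m = 2 * k) (hk : 4 ≤ k)
    (hc : HasConsecutiveEdges U m v 4) :
    ∃ (l : ℝ) (C : ℂ), ∀ i : ℤ, v (i + 2 : ℤ) + v (i - 2 : ℤ) = (l : ℂ) * v i + C := by
  obtain ⟨-, e, he⟩ := hc
  obtain ⟨a, rfl⟩ := ZMod.intCast_surjective e
  have he' : ∀ j : ℕ, j < 4 → ∃ u ∈ U,
      cross (u : ℂ) (v (a + j + 1 : ℤ)) = cross u (v (a + j : ℤ)) := by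
    intro j hj
    obtain ⟨u, hu, h⟩ := he j hj
    refine ⟨u, hu, ?_⟩
    rw [Parallel, cross_sub_right, sub_eq_zero] at h
    simpa using h
  obtain ⟨p, hpU, hp⟩ := he' 0 (by omega)
  obtain ⟨q, hqU, hq⟩ := he' 1 (by omega)
  obtain ⟨r, hrU, hr⟩ := he' 2 (by omega)
  obtain ⟨t, htU, ht⟩ := he' 3 (by omega)
  refine UPoly.exists_recurrence (w := fun i : ℤ => v i) (p := p) (q := q) (r := r) (t := t)
    (s := 2 * a + 1) ⟨a, rfl⟩
    (fun i => ?_) (fun i => ?_) (fun i => ?_) (fun i => ?_)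
    (hP.cross_ne_zero hmk hqU hp hq (by simp) (by simp; omega))
    (hP.cross_ne_zero hmk hrU hq hr (by simp) (by simp; omega))
    (hP.cross_ne_zero hmk hrU hp hr (by simp) (by simp; omega))
    (hP.cross_ne_zero hmk htU hr ht (by simp) (by simp; omega))
  · rw [← hP.cross_reflect hmk hpU hp i]; congr 3; push_cast; ring
  · rw [← hP.cross_reflect hmk hqU hq i]; congr 3; push_cast; ring
  · rw [← hP.cross_reflect hmk hrU hr i]; congr 3; push_cast; ring
  · rw [← hP.cross_reflect hmk htU ht i]; congr 3; push_cast; ring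

/-! ### Periodic solutions of the recurrence -/

lemma eq_zpow_mul_of_succ {e : ℤ → ℂ} {b : ℂ} (hb : b ≠ 0) (h : ∀ j, e (j + 1) = b * e j) (j : ℤ) :
    e j = b ^ j * e 0 := by
  induction j using Int.induction_on with
  | zero => simp
  | succ j ih => rw [h, ih, zpow_add_one₀ hb]; ring
  | pred j ih =>
    have := h (-(j : ℤ) - 1)
    rw [sub_add_cancel, ih] at this
    rw [zpow_sub_one₀ hb]
    field_simp
    linear_combination -this

lemma eq_add_mul_of_succ {e : ℤ → ℂ} {b : ℂ} (h : ∀ j, e (j + 1) = e j + b) (j : ℤ) :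
    e j = e 0 + j * b := by
  induction j using Int.induction_on with
  | zero => simp
  | succ j ih => rw [h, ih]; push_cast; ring
  | pred j ih =>
    have := h (-(j : ℤ) - 1)
    rw [sub_add_cancel, ih] at this
    push_cast at *
    linear_combination -this

/-- A homogeneous recurrence with exact period `k` comes from a primitive `k`-th root of unity. -/
lemma exists_isPrimitiveRoot_of_homogeneous {G : ℤ → ℂ} {k : ℕ} (hk : 2 ≤ k) {a : ℂ} (ha0 : a ≠ 0)
    (hper : ∀ i j : ℤ, G i = G j ↔ (k : ℤ) ∣ i - j)
    (hrec : ∀ i, G (i + 1) + G (i - 1) = (a + a⁻¹) * G i) :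
    IsPrimitiveRoot a k := by
  have hperiod : ∀ i, G (i + k) = G i := fun i => (hper _ _).2 (by simp)
  have aux : ∀ b : ℂ, b ≠ 0 → (∀ i, G (i + 1) = b * G i) → IsPrimitiveRoot b k := by
    intro b hb h
    have h1 := eq_zpow_mul_of_succ hb h
    have h0 : G 0 ≠ 0 := by
      intro h0
      have : G 1 = G 0 := by rw [h1 1, h0, mul_zero]
      rw [hper] at this
      have := Int.le_of_dvd (by norm_num) this
      omega
    have key : ∀ j : ℕ, b ^ j = 1 ↔ k ∣ j := by
      intro j
      have := hper j 0
      rw [h1 j, mul_eq_right₀ h0, sub_zero, zpow_natCast, Int.natCast_dvd_natCast] at this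
      exact this
    exact ⟨(key k).2 dvd_rfl, fun l => (key l).1⟩
  -- Factoring the recurrence: `e` and `e'` are geometric with ratios `a⁻¹` and `a`. If either
  -- vanishes, `G` itself is geometric and its exact period is the order of its ratio.
  set e : ℤ → ℂ := fun i => G (i + 1) - a * G i with he
  set e' : ℤ → ℂ := fun i => G (i + 1) - a⁻¹ * G i with he'
  have he1 : ∀ i, e (i + 1) = a⁻¹ * e i := by
    intro i
    have := hrec (i + 1)
    simp only [he]
    rw [add_sub_cancel_right] at this
    linear_combination this + G i * inv_mul_cancel₀ ha0
  have he1' : ∀ i, e' (i + 1) = a * e' i := by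
    intro i
    have := hrec (i + 1)
    simp only [he']
    rw [add_sub_cancel_right] at this
    linear_combination this + G i * inv_mul_cancel₀ ha0
  have he2 := eq_zpow_mul_of_succ (inv_ne_zero ha0) he1
  have he2' := eq_zpow_mul_of_succ ha0 he1'
  by_cases h0 : e 0 = 0
  · refine aux a ha0 fun i => ?_
    have := he2 i
    rw [h0, mul_zero] at this
    exact sub_eq_zero.1 this
  by_cases h0' : e' 0 = 0
  · refine IsPrimitiveRoot.inv_iff.1 (aux a⁻¹ (inv_ne_zero ha0) fun i => ?_)
    have := he2' i
    rw [h0', mul_zero] at this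
    exact sub_eq_zero.1 this
  have hak : a ^ k = 1 := by
    have h1 : e' k = e' 0 := by
      have h2 := hperiod 0
      have h3 := hperiod 1
      simp only [he']
      rw [add_comm (k : ℤ) 1, h3]
      rw [zero_add] at h2
      rw [h2, zero_add]
    rw [he2', mul_eq_right₀ h0', zpow_natCast] at h1
    exact h1
  by_cases haa : a = a⁻¹
  · exfalso
    have hsq : a * a = 1 := by nth_rewrite 2 [haa]; exact mul_inv_cancel₀ ha0
    -- Double root `a = ±1`: here `a ^ j * G j` is an arithmetic progression with nonzero
    -- difference, contradicting periodicity.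
    have hD := eq_add_mul_of_succ (e := fun j => a ^ j * G j) (b := a * e 0) (fun j => by
      have h1 := he2 j
      rw [← haa] at h1
      simp only [he] at h1 ⊢
      have h2 : (a ^ j) * a ^ j = 1 := by rw [← mul_zpow, hsq, one_zpow]
      rw [zpow_add_one₀ ha0]
      linear_combination a ^ j * a * h1 + a * (G (0 + 1) - a * G 0) * h2 + a ^ j * G j * hsq)
    have h1 := hD (k : ℤ)
    have h2 := hperiod 0
    rw [zero_add] at h2
    simp only [zpow_natCast, hak, h2, zpow_zero, left_eq_add, Int.cast_natCast, mul_eq_zero, ha0,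
      h0, or_false, Nat.cast_eq_zero] at h1
    omega
  · refine ⟨hak, fun l hl => ?_⟩
    have h1 : ∀ i, (a - a⁻¹) * G i = e' i - e i := fun i => by simp only [he, he']; ring
    have h2 : G l = G 0 := by
      apply mul_left_cancel₀ (sub_ne_zero.2 haa)
      rw [h1, h1, he2, he2']
      simp [hl]
    simpa [Int.natCast_dvd_natCast] using (hper _ _).1 h2

/-- A recurrence with exact period `k` comes from a primitive `k`-th root of unity. -/
lemma exists_isPrimitiveRoot_of_recurrence {g : ℤ → ℂ} {k : ℕ} (hk : 2 ≤ k) {l C : ℂ}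
    (hper : ∀ i j : ℤ, g i = g j ↔ (k : ℤ) ∣ i - j)
    (hrec : ∀ i, g (i + 1) + g (i - 1) = l * g i + C) :
    ∃ a : ℂ, IsPrimitiveRoot a k ∧ a + a⁻¹ = l := by
  obtain ⟨s, hs⟩ := IsAlgClosed.exists_pow_nat_eq (l ^ 2 - 4) (n := 2) (by norm_num)
  obtain ⟨a, ha⟩ : ∃ a, a = (l + s) / 2 := ⟨_, rfl⟩
  have hroot : a * (l - a) = 1 := by rw [ha]; linear_combination -(1 / 4 : ℂ) * hs
  have ha0 : a ≠ 0 := by rintro rfl; simp at hroot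
  have hal : a + a⁻¹ = l := by
    rw [inv_eq_of_mul_eq_one_right hroot]
    ring
  -- For `a = 1` second differences are constant, and a periodic sequence of this kind is constant.
  -- Otherwise `l ≠ 2`, and subtracting the fixed point `C / (2 - l)` makes the recurrence
  -- homogeneous.
  by_cases ha1 : a = 1
  · exfalso
    have hl : l = 2 := by rw [← hal, ha1]; norm_num
    have h1 := eq_add_mul_of_succ (e := fun i => g (i + 1) - g i) (b := C) (fun i => by
      have := hrec (i + 1)
      rw [add_sub_cancel_right, hl] at this
      linear_combination this)
    have hk0 : (k : ℂ) ≠ 0 := by norm_cast; omega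
    have p0 : g k = g 0 := (hper _ _).2 (by simp)
    have p1 : g (k + 1) = g 1 := (hper _ _).2 (by simp)
    have hC : C = 0 := by
      have := h1 k
      simp only [p0, p1, zero_add, left_eq_add, Int.cast_natCast, mul_eq_zero, hk0, false_or] at this
      exact this
    have h2 := eq_add_mul_of_succ (e := g) (b := g 1 - g 0) (fun i => by
      have := h1 i
      rw [hC] at this
      simp only [zero_add] at this
      linear_combination this) k
    rw [p0] at h2
    simp only [left_eq_add, Int.cast_natCast, mul_eq_zero, hk0, false_or, sub_eq_zero] at h2
    rw [hper] at h2
    have := Int.le_of_dvd (by norm_num) h2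
    omega
  · have hl2 : 2 - l ≠ 0 := by
      intro h
      have h3 : (a - 1) ^ 2 = 0 := by linear_combination -hroot - a * h
      exact ha1 (sub_eq_zero.1 (pow_eq_zero_iff two_ne_zero |>.1 h3))
    refine ⟨a, exists_isPrimitiveRoot_of_homogeneous (G := fun i => g i - C / (2 - l)) hk ha0
      (fun i j => by simp [hper]) (fun i => ?_), hal⟩
    simp only [hal]
    have := hrec i
    field_simp
    linear_combination (2 - l) * this

/-- The trace of a primitive root of unity arising from a `U`-polygon with vertices in the translate
of a field lies in that field. -/
lemma IsUPolygon.exists_isPrimitiveRoot {U : Finset Circle} {m k : ℕ} {v : ZMod m → ℂ}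
    (hP : IsUPolygon U m v) (hmk : m = 2 * k) (hk : 4 ≤ k)
    (hc : HasConsecutiveEdges U m v 4) (K : IntermediateField ℚ ℂ)
    (hK : ∀ i j, v i - v j ∈ K) :
    ∃ a : ℂ, IsPrimitiveRoot a k ∧ a + a⁻¹ ∈ K := by
  obtain ⟨l, C, h⟩ := hP.exists_recurrence hmk hk hc
  have hne : v (2 : ℤ) - v (0 : ℤ) ≠ 0 := by
    rw [sub_ne_zero]
    exact fun h => zmod_intCast_ne (m := m) (a := 0) (b := 2) (by norm_num) (by omega)
      (hP.convex.injective h).symm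
  have hl : (l : ℂ) ∈ K := by
    have h1 := h 2
    have h0 := h 0
    have : (l : ℂ) = ((v (2 + 2 : ℤ) - v (0 + 2 : ℤ)) + (v (2 - 2 : ℤ) - v (0 - 2 : ℤ)))
        / (v (2 : ℤ) - v (0 : ℤ)) := by
      rw [eq_div_iff hne]
      linear_combination h0 - h1
    rw [this]
    exact div_mem (add_mem (hK _ _) (hK _ _)) (hK _ _)
  -- The recurrence has step 2, so it is applied to the even-indexed vertices, whose exact period is
  -- `k`.
  obtain ⟨a, ha, hal⟩ := exists_isPrimitiveRoot_of_recurrence (g := fun i : ℤ => v (2 * i : ℤ))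
    (k := k) (by omega) (l := l) (C := C) (fun i j => by
      rw [hP.convex.injective.eq_iff, eq_comm, ZMod.intCast_eq_intCast_iff_dvd_sub, hmk, ← mul_sub]
      push_cast
      exact mul_dvd_mul_iff_left two_ne_zero) (fun i => by
      rw [← h (2 * i)]; ring_nf)
  exact ⟨a, ha, hal ▸ hl⟩

/-! ### Real cyclotomic fields -/

lemma isPrimitiveRoot_zeta {n : ℕ} (hn : n ≠ 0) : IsPrimitiveRoot (zeta n) n :=
  Complex.isPrimitiveRoot_exp n hn

open Polynomial in
lemma exists_aeval_zeta_eq {n : ℕ} (hn : n ≠ 0) {z : ℂ} (hz : z ∈ cycField n) :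
    ∃ P : ℚ[X], aeval (zeta n) P = z := by
  have hint : IsAlgebraic ℚ (zeta n) :=
    ((isPrimitiveRoot_zeta hn).isIntegral (Nat.pos_of_ne_zero hn)).tower_top.isAlgebraic
  have h : z ∈ (cycField n).toSubalgebra := hz
  rw [cycField, IntermediateField.adjoin_simple_toSubalgebra_of_isAlgebraic hint,
    Algebra.adjoin_singleton_eq_range_aeval] at h
  exact h

open Polynomial in
/-- A rational polynomial vanishing at a primitive root of unity vanishes at its conjugates. -/
lemma aeval_pow_eq_zero {N b : ℕ} (hN : 0 < N) (hb : b.Coprime N) {η : ℂ}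
    (hη : IsPrimitiveRoot η N) {h : ℚ[X]} (h0 : aeval η h = 0) : aeval (η ^ b) h = 0 := by
  have h1 : minpoly ℚ η = minpoly ℚ (η ^ b) := by
    rw [← cyclotomic_eq_minpoly_rat hη hN,
      ← cyclotomic_eq_minpoly_rat (hη.pow_of_coprime b hb) hN]
  exact aeval_eq_zero_of_dvd_aeval_eq_zero (h1 ▸ minpoly.dvd ℚ η h0) (minpoly.aeval ℚ _)

open Polynomial in
/-- If the trace of a primitive `k`-th root of unity lies in `ℚ(ζ_n)`, then an automorphism fixing
`ζ_n` fixes this root or inverts it. -/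
lemma dvd_sub_one_or_dvd_add_one {n k b : ℕ} (hn : n ≠ 0) (hk : k ≠ 0) {a : ℂ}
    (ha : IsPrimitiveRoot a k) (hK : a + a⁻¹ ∈ cycField n) (hbn : b ≡ 1 [MOD n])
    (hbk : b.Coprime k) : (k : ℤ) ∣ b - 1 ∨ (k : ℤ) ∣ b + 1 := by
  obtain ⟨P, hP⟩ := exists_aeval_zeta_eq hn hK
  have hN : n * k ≠ 0 := mul_ne_zero hn hk
  have : NeZero (n * k) := ⟨hN⟩
  have ha0 : a ≠ 0 := ha.ne_zero hk
  have hz := isPrimitiveRoot_zeta hn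
  have hη := isPrimitiveRoot_zeta hN
  obtain ⟨x, -, hx⟩ := hη.eq_pow_of_pow_eq_one (show a ^ (n * k) = 1 by
    rw [mul_comm, pow_mul, ha.pow_eq_one, one_pow])
  obtain ⟨y, -, hy⟩ := hη.eq_pow_of_pow_eq_one (show zeta n ^ (n * k) = 1 by
    rw [pow_mul, hz.pow_eq_one, one_pow])
  have hinv : a ^ (k - 1) = a⁻¹ := by
    rw [← mul_right_inj' ha0, mul_inv_cancel₀ ha0, mul_pow_sub_one hk, ha.pow_eq_one]
  have hbN : b.Coprime (n * k) := by
    refine Nat.Coprime.mul_right ?_ hbk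
    have := hbn.gcd_eq
    rwa [Nat.gcd_one_left] at this
  -- This is the automorphism `η ↦ η ^ b` of `ℚ(ζ_{nk})`, applied to `a + a⁻¹ = P(ζ_n)`. It fixes
  -- `ζ_n` because `b ≡ 1` modulo `n`.
  have key := aeval_pow_eq_zero (Nat.pos_of_ne_zero hN) hbN hη
    (h := X ^ x + X ^ (x * (k - 1)) - P.comp (X ^ y)) (by
      simp only [map_sub, map_add, map_pow, aeval_X, aeval_comp]
      rw [pow_mul, hx, hy, hinv, hP, sub_self])
  simp only [map_sub, map_add, map_pow, aeval_X, aeval_comp] at key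
  have e1 : (zeta (n * k) ^ b) ^ x = a ^ b := by rw [← hx, pow_right_comm]
  have e2 : (zeta (n * k) ^ b) ^ y = zeta n := by
    rw [pow_right_comm, hy, pow_eq_pow_mod b hz.pow_eq_one, show b % n = 1 % n from hbn,
      ← pow_eq_pow_mod 1 hz.pow_eq_one, pow_one]
  rw [pow_mul, e1, e2, hP, pow_right_comm, hinv, inv_pow] at key
  have hprod : (a ^ b - a) * (a ^ b * a - 1) = 0 := by
    have hab : a ^ b ≠ 0 := pow_ne_zero _ ha0
    field_simp at key
    linear_combination key
  rcases mul_eq_zero.1 hprod with h | h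
  · left
    rw [← ha.zpow_eq_one_iff_dvd, zpow_sub_one₀ ha0, zpow_natCast, sub_eq_zero.1 h,
      mul_inv_cancel₀ ha0]
  · right
    rw [← ha.zpow_eq_one_iff_dvd, zpow_add_one₀ ha0, zpow_natCast, sub_eq_zero.1 h]

/-- If the units modulo `k` which reduce to `1` modulo a divisor `g > 2` are only `1` and `-1`, then
`k` and `g` have the same totient. -/
lemma totient_eq_of_forall_units {k g : ℕ} (hk : k ≠ 0) (hg : 2 < g) (hgk : g ∣ k)
    (h : ∀ u : (ZMod k)ˣ, ZMod.unitsMap hgk u = 1 → u = 1 ∨ u = -1) :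
    k.totient = g.totient := by
  have : NeZero k := ⟨hk⟩
  have : NeZero g := ⟨by omega⟩
  have : Fact (2 < g) := ⟨hg⟩
  have hinj : Function.Injective (ZMod.unitsMap hgk) := by
    rw [injective_iff_map_eq_one]
    intro u hu
    rcases h u hu with h1 | rfl
    · exact h1
    · exfalso
      have := congrArg Units.val hu
      rw [ZMod.unitsMap_val] at this
      simp only [Units.val_neg, Units.val_one, ZMod.cast_neg hgk, ZMod.cast_one hgk] at this
      exact ZMod.neg_one_ne_one this
  rw [← ZMod.card_units_eq_totient, ← ZMod.card_units_eq_totient]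
  exact Fintype.card_of_bijective ⟨hinj, ZMod.unitsMap_surjective hgk⟩

/-- Orders of roots of unity with trace in `ℚ(ζ_n)`. -/
lemma order_of_trace_mem_cycField {n k : ℕ} (hn : n ≠ 0) (hk : 4 ≤ k) {a : ℂ}
    (ha : IsPrimitiveRoot a k) (hK : a + a⁻¹ ∈ cycField n) :
    k = 4 ∨ k = 6 ∨ k ∣ n ∨ ∃ g, Odd g ∧ g ∣ n ∧ k = 2 * g := by
  -- By the Chinese remainder theorem a unit modulo `k` that is 1 modulo `gcd(k, n)` lifts to some
  -- `b` with `b ≡ 1` modulo `n`.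
  have hlift : ∀ c : ℕ, c.Coprime k → c ≡ 1 [MOD k.gcd n] → (k : ℤ) ∣ c - 1 ∨ (k : ℤ) ∣ c + 1 := by
    intro c hc h1
    obtain ⟨b, hbk, hbn⟩ := Nat.chineseRemainder' h1
    have hd : (k : ℤ) ∣ c - b := (Nat.modEq_iff_dvd.1 hbk)
    rcases dvd_sub_one_or_dvd_add_one hn (by omega) ha hK hbn (by
      rw [Nat.Coprime, hbk.gcd_eq]; exact hc) with h | h
    · left; simpa using dvd_add hd h
    · right; rw [show (c : ℤ) + 1 = (c - b) + (b + 1) by ring]; exact dvd_add hd h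
  have hgk := Nat.gcd_dvd_left k n
  have hgn := Nat.gcd_dvd_right k n
  set g := k.gcd n with hg
  by_cases hg2 : 2 < g
  · have htot := totient_eq_of_forall_units (by omega) hg2 hgk (fun u hu => by
      have : NeZero k := ⟨by omega⟩
      have hc := hlift (u : ZMod k).val (ZMod.val_coe_unit_coprime u) (by
        have := congrArg Units.val hu
        rw [ZMod.unitsMap_val, Units.val_one, ← ZMod.natCast_val] at this
        rw [← ZMod.natCast_eq_natCast_iff]
        simpa using this)
      rcases hc with hc | hc
      · left
        rw [← ZMod.intCast_zmod_eq_zero_iff_dvd] at hc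
        ext
        simpa [sub_eq_zero] using hc
      · right
        rw [← ZMod.intCast_zmod_eq_zero_iff_dvd] at hc
        ext
        simpa [add_eq_zero_iff_eq_neg] using hc)
    rcases Nat.eq_or_eq_of_totient_eq_totient hgk htot.symm with h | h
    · exact Or.inr (Or.inr (Or.inl (h ▸ hgn)))
    · refine Or.inr (Or.inr (Or.inr ⟨g, ?_, hgn, h.symm⟩))
      by_contra hodd
      have := Nat.totient_two_mul_of_even (Nat.not_odd_iff_even.1 hodd)
      rw [h, htot] at this
      have := Nat.totient_pos.2 (by omega : 0 < g)
      omega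
  · have hg2' : g ∣ 2 := by
      have : 0 < g := Nat.gcd_pos_of_pos_left _ (by omega)
      interval_cases g <;> norm_num
    have hodd : ∀ c : ℕ, Odd c → c.Coprime k → (k : ℤ) ∣ c - 1 ∨ (k : ℤ) ∣ c + 1 := fun c hc h =>
      hlift c h ((show c ≡ 1 [MOD 2] from Nat.odd_iff.1 hc).of_dvd hg2')
    -- With `g ≤ 2` one explicit unit suffices: `l + 1` or `l + 2` for `k = 2 * l` with `l` even or
    -- odd, and `2` for `k` odd. Being `±1` modulo `k` leaves only 4 and 6.
    rcases Nat.even_or_odd' k with ⟨l, rfl | rfl⟩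
    · rcases Nat.even_or_odd l with hl | hl
      · left
        have hc : (l + 1).Coprime (2 * l) := Nat.Coprime.mul_right
          (Nat.coprime_two_right.2 hl.add_one) (by simp)
        rcases hodd (l + 1) hl.add_one hc with h | h
        · have := Int.le_of_dvd (by push_cast; omega) h
          push_cast at this; omega
        · obtain ⟨q, hq⟩ := h
          push_cast at hq
          have h2 : (l : ℤ) ∣ 2 := ⟨2 * q - 1, by linarith⟩
          have := Int.le_of_dvd (by norm_num) h2
          omega
      · right; left
        have hc : (l + 2).Coprime (2 * l) := Nat.Coprime.mul_right
          (Nat.coprime_two_right.2 (hl.add_even even_two))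
          (by simpa using Nat.coprime_two_left.2 hl)
        rcases hodd (l + 2) (hl.add_even even_two) hc with h | h
        · have := Int.le_of_dvd (by push_cast; omega) h
          push_cast at this; omega
        · obtain ⟨q, hq⟩ := h
          push_cast at hq
          have h2 : (l : ℤ) ∣ 3 := ⟨2 * q - 1, by linarith⟩
          have := Int.le_of_dvd (by norm_num) h2
          obtain ⟨r, rfl⟩ := hl
          omega
    · exfalso
      have hg1 : g = 1 := by
        have h3 : g ∣ 2 * l + 1 := hgk
        rcases (Nat.dvd_prime Nat.prime_two).1 hg2' with h | h
        · exact h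
        · rw [h] at h3; omega
      rcases hlift 2 (by simp) (by rw [hg1]; exact Nat.modEq_one) with h | h
      · have := Int.le_of_dvd (by norm_num) h
        push_cast at this; omega
      · have := Int.le_of_dvd (by norm_num) h
        push_cast at this; omega

/-! ### Cyclotomic model sets contain homothetic copies of finite sets of cyclotomic integers -/

lemma zeta_eq {n : ℕ} : zeta n = Complex.exp (((2 * Real.pi / n : ℝ) : ℂ) * Complex.I) := by
  unfold zeta; congr 1; push_cast; ring

lemma zeta_im_pos {n : ℕ} (hn : 3 ≤ n) : 0 < (zeta n).im := by
  rw [zeta_eq, Complex.exp_ofReal_mul_I_im]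
  have h3 : (3 : ℝ) ≤ n := by exact_mod_cast hn
  apply Real.sin_pos_of_pos_of_lt_pi
  · positivity
  · rw [div_lt_iff₀ (by linarith)]
    nlinarith [Real.pi_pos]

lemma zeta_mem_cycField (n : ℕ) : zeta n ∈ cycField n :=
  IntermediateField.mem_adjoin_simple_self ℚ _

lemma zeta_mem_cycRing (n : ℕ) : zeta n ∈ cycRing n :=
  Algebra.subset_adjoin rfl

/-- The generator `ζ_n` of the cyclotomic field. -/
noncomputable def gen (n : ℕ) : cycField n := ⟨zeta n, zeta_mem_cycField n⟩

lemma mem_cycField_of_mem_cycRing {n : ℕ} {z : ℂ} (hz : z ∈ cycRing n) : z ∈ cycField n := by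
  have : cycRing n ≤ (cycField n).toSubalgebra.restrictScalars ℤ :=
    Algebra.adjoin_le (by rintro _ rfl; exact zeta_mem_cycField n)
  exact this hz

/-- The ring `ℤ[ζ_n]` as a subalgebra of the cyclotomic field. -/
noncomputable def cycIntegers (n : ℕ) : Subalgebra ℤ (cycField n) :=
  (cycRing n).comap ((cycField n).val.restrictScalars ℤ)

lemma isCyclotomicExtension_cycField {n : ℕ} (hn : n ≠ 0) :
    IsCyclotomicExtension {n} ℚ (cycField n) := by
  have : NeZero n := ⟨hn⟩
  have hz := isPrimitiveRoot_zeta hn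
  have hint : IsAlgebraic ℚ (zeta n) :=
    (hz.isIntegral (Nat.pos_of_ne_zero hn)).tower_top.isAlgebraic
  have hgen : IsPrimitiveRoot (gen n) n := IsPrimitiveRoot.coe_submonoidClass_iff.1 hz
  have htop : ∀ x : cycField n, x ∈ Algebra.adjoin ℚ {gen n} := by
    intro x
    have hx : (x : ℂ) ∈ Algebra.adjoin ℚ {zeta n} := by
      rw [← IntermediateField.adjoin_simple_toSubalgebra_of_isAlgebraic hint]
      exact x.2
    have h1 : Subalgebra.map (cycField n).val (Algebra.adjoin ℚ {gen n})
        = Algebra.adjoin ℚ {zeta n} := by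
      rw [AlgHom.map_adjoin, Set.image_singleton, IntermediateField.coe_val, gen]
    rw [← h1] at hx
    obtain ⟨y, hy, hyx⟩ := hx
    have hyx' : y = x := Subtype.ext hyx
    exact hyx' ▸ hy
  rw [IsCyclotomicExtension.iff_singleton]
  refine ⟨⟨gen n, hgen⟩, fun x => ?_⟩
  have hsub : ({gen n} : Set (cycField n)) ⊆ {b | b ^ n = 1} := by
    rw [Set.singleton_subset_iff, Set.mem_ofPred_eq]
    exact hgen.pow_eq_one
  have hle := Algebra.adjoin_mono (R := ℚ) hsub
  exact hle (htop x)

/-- The ring of integers of `ℚ(ζ_n)` is `ℤ[ζ_n]`; this places the unit supplied by Dirichlet's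
theorem in the module underlying the model set. -/
lemma mem_cycIntegers_of_isIntegral {n : ℕ} (hn : n ≠ 0) {z : cycField n} (hz : IsIntegral ℤ z) :
    z ∈ cycIntegers n := by
  have : NeZero n := ⟨hn⟩
  have := isCyclotomicExtension_cycField hn
  have := IsCyclotomicExtension.numberField {n} ℚ (cycField n)
  have hgen : IsPrimitiveRoot (gen n) n :=
    IsPrimitiveRoot.coe_submonoidClass_iff.1 (isPrimitiveRoot_zeta hn)
  obtain ⟨y, rfl⟩ :=
    (IsCyclotomicExtension.Rat.isIntegralClosure_adjoin_singleton hgen).isIntegral_iff.1 hz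
  have h : Algebra.adjoin ℤ {gen n} ≤ cycIntegers n :=
    Algebra.adjoin_le (by rintro _ rfl; exact zeta_mem_cycRing n)
  exact h y.2

section StarFamily

variable {n : ℕ} {σ : Fin (Nat.totient n / 2 - 1) → (cycField n ≃ₐ[ℚ] cycField n)}

/-- Elements of a star family are pairwise neither equal nor conjugate. -/
lemma IsStarFamily.eq_of_eq_or_conjugate (hσ : IsStarFamily n σ) {i j}
    (h : σ i = σ j ∨ ConjugateAut (σ i) (σ j)) : i = j :=
  (hσ.exactly_one (σ j) (hσ.ne_id j) (hσ.ne_conj j)).unique h (Or.inl rfl)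

lemma not_conjugateAut_self (hn : 3 ≤ n) (τ : cycField n ≃ₐ[ℚ] cycField n) :
    ¬ ConjugateAut τ τ := by
  intro h
  have := h (τ.symm (gen n))
  rw [τ.apply_symm_apply] at this
  have him := congrArg Complex.im this
  rw [Complex.conj_im] at him
  have := zeta_im_pos hn
  change (zeta n).im = -(zeta n).im at him
  linarith

/-- There is a nonzero cyclotomic integer on which the star map is contracting. -/
lemma IsStarFamily.exists_contracting (hn : 3 ≤ n) (hσ : IsStarFamily n σ) :
    ∃ l : cycField n, l ∈ cycIntegers n ∧ l ≠ 0 ∧ ∀ j, ‖starMap σ l j‖ < 1 := by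
  have hn0 : n ≠ 0 := by omega
  have : NeZero n := ⟨hn0⟩
  have := isCyclotomicExtension_cycField hn0
  have := IsCyclotomicExtension.numberField {n} ℚ (cycField n)
  -- Dirichlet's theorem gives a unit of absolute value less than 1 at every place except that of
  -- the identity embedding; the family `σ` avoids exactly this place.
  obtain ⟨u, hu⟩ := NumberField.Units.dirichletUnitTheorem.exists_unit (cycField n)
    (NumberField.InfinitePlace.mk (cycField n).val.toRingHom)
  have hu0 : (algebraMap (NumberField.RingOfIntegers (cycField n)) (cycField n)) u ≠ 0 := by
    simp
  refine ⟨_, mem_cycIntegers_of_isIntegral hn0 (NumberField.RingOfIntegers.isIntegral_coe u.1),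
    hu0, fun j => ?_⟩
  have h1 := hu (NumberField.InfinitePlace.mk
    ((cycField n).val.toRingHom.comp (σ j : cycField n ≃+* cycField n).toRingHom)) (by
      rw [Ne, NumberField.InfinitePlace.mk_eq_iff, not_or]
      constructor
      · intro h
        apply hσ.ne_id j
        ext z
        exact RingHom.congr_fun h z
      · intro h
        apply hσ.ne_conj j
        intro z
        have := RingHom.congr_fun h z
        rw [NumberField.ComplexEmbedding.conjugate_coe_eq] at this
        exact (star_eq_iff_star_eq.1 this).symm)
  rw [NumberField.InfinitePlace.apply] at h1
  by_contra hlt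
  exact absurd h1 (not_lt.2 (Real.log_nonneg (not_lt.1 hlt)))

/-- The star map as a homomorphism of additive groups. -/
noncomputable def starHom (σ : Fin (Nat.totient n / 2 - 1) → (cycField n ≃ₐ[ℚ] cycField n)) :
    cycField n →+ (Fin (Nat.totient n / 2 - 1) → ℂ) where
  toFun := starMap σ
  map_zero' := by ext; simp [starMap]
  map_add' x y := by ext; simp [starMap]

lemma starMap_mul (x y : cycField n) : starMap σ (x * y) = starMap σ x * starMap σ y := by
  ext; simp [starMap]

lemma starMap_pow (x : cycField n) (N : ℕ) : starMap σ (x ^ N) = starMap σ x ^ N := by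
  ext; simp [starMap]

lemma algHom_ext_gen {φ ψ : cycField n →ₐ[ℚ] ℂ} (h : φ (gen n) = ψ (gen n)) : φ = ψ :=
  IntermediateField.algHom_ext_of_eq_adjoin ℚ (S := cycField n) rfl (by rintro _ rfl; exact h)

/-- The embeddings attached to a star family and their conjugates. -/
noncomputable def starEmbedding (σ : Fin (Nat.totient n / 2 - 1) → (cycField n ≃ₐ[ℚ] cycField n)) :
    Fin (Nat.totient n / 2 - 1) ⊕ Fin (Nat.totient n / 2 - 1) → (cycField n →ₐ[ℚ] ℂ)
  | .inl j => (cycField n).val.comp (σ j).toAlgHom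
  | .inr j => (Complex.conjAe.toAlgHom.restrictScalars ℚ).comp
      ((cycField n).val.comp (σ j).toAlgHom)

/-- Distinctness is what independence of characters requires in `IsStarFamily.span_starMap`. -/
lemma IsStarFamily.starEmbedding_injective (hn : 3 ≤ n) (hσ : IsStarFamily n σ) :
    Function.Injective (starEmbedding σ) := by
  have hll : ∀ i j, (∀ z, (σ i z : ℂ) = σ j z) → i = j := fun i j h =>
    hσ.eq_of_eq_or_conjugate (Or.inl (by ext z; exact h z))
  have hlr : ∀ i j, ¬ ∀ z, (σ i z : ℂ) = (starRingEnd ℂ) (σ j z) := by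
    intro i j h
    obtain rfl := hσ.eq_of_eq_or_conjugate (Or.inr h)
    exact not_conjugateAut_self hn _ h
  rintro (i | i) (j | j) h
  · exact congrArg _ (hll i j fun z => AlgHom.congr_fun h z)
  · exact (hlr i j fun z => AlgHom.congr_fun h z).elim
  · exact (hlr j i fun z => (AlgHom.congr_fun h z).symm).elim
  · refine congrArg _ (hll i j fun z => ?_)
    exact (starRingEnd ℂ).injective (AlgHom.congr_fun h z)

/-- The star image of `ℤ[ζ_n]` spans the internal space over the reals. -/
lemma IsStarFamily.span_starMap (hn : 3 ≤ n) (hσ : IsStarFamily n σ) :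
    ⊤ ≤ Submodule.span ℝ (starMap σ '' cycIntegers n) := by
  by_contra hlt
  obtain ⟨f, hf0, hf⟩ := Submodule.exists_le_ker_of_lt_top _
    (lt_top_iff_ne_top.2 fun h => hlt h.ge)
  apply hf0
  have hfz : ∀ z ∈ cycIntegers n, f (starMap σ z) = 0 := fun z hz =>
    LinearMap.mem_ker.1 (hf (Submodule.subset_span ⟨z, hz, rfl⟩))
  set A := fun j => f (Pi.single j 1) with hA
  set B := fun j => f (Pi.single j Complex.I) with hB
  have hsingle : ∀ j (w : ℂ), f (Pi.single j w) = w.re * A j + w.im * B j := by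
    intro j w
    have : (Pi.single j w : Fin (Nat.totient n / 2 - 1) → ℂ)
        = w.re • (Pi.single j 1 : Fin (Nat.totient n / 2 - 1) → ℂ)
          + w.im • (Pi.single j Complex.I : Fin (Nat.totient n / 2 - 1) → ℂ) := by
      rw [← Pi.single_smul, ← Pi.single_smul, ← Pi.single_add]
      congr 1
      simp [Complex.re_add_im]
    rw [this, map_add, map_smul, map_smul, smul_eq_mul, smul_eq_mul]
  have hsum : ∀ x, f x = ∑ j, ((x j).re * A j + (x j).im * B j) := by
    intro x
    conv_lhs => rw [← Finset.univ_sum_single x]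
    rw [map_sum]
    exact Finset.sum_congr rfl fun j _ => hsingle j _
  -- Chosen so that `Re (c j * w) = A j * w.re + B j * w.im`. A functional vanishing on the star
  -- image thus becomes a complex relation between the embeddings and their conjugates.
  set c : Fin (Nat.totient n / 2 - 1) → ℂ := fun j => ⟨A j, -B j⟩ with hc
  have hinj : Function.Injective
      (fun i => ((starEmbedding σ i : cycField n →* ℂ).comp
        (cycIntegers n).toSubmonoid.subtype : (cycIntegers n).toSubmonoid →* ℂ)) := by
    intro i j h
    apply hσ.starEmbedding_injective hn
    exact algHom_ext_gen (DFunLike.congr_fun h ⟨gen n, zeta_mem_cycRing n⟩)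
  have hli := (linearIndependent_monoidHom (cycIntegers n).toSubmonoid ℂ).comp _ hinj
  rw [Fintype.linearIndependent_iff] at hli
  have hzero := hli (Sum.elim c fun j => (starRingEnd ℂ) (c j)) (by
    ext z
    rw [Fintype.sum_sum_type, Pi.add_apply, Finset.sum_apply, Finset.sum_apply,
      ← Finset.sum_add_distrib]
    have h0 := hfz z z.2
    rw [hsum] at h0
    have h1 : ∀ j, c j * (σ j z : ℂ) + (starRingEnd ℂ) (c j) * (starRingEnd ℂ) (σ j z : ℂ)
        = ((2 * ((starMap σ z j).re * A j + (starMap σ z j).im * B j) : ℝ) : ℂ) := by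
      intro j
      rw [← map_mul, Complex.add_conj]
      simp only [hc, starMap, Complex.mul_re]
      congr 1; ring
    calc _ = ∑ j, (c j * (σ j z : ℂ) + (starRingEnd ℂ) (c j) * (starRingEnd ℂ) (σ j z : ℂ)) := rfl
      _ = 0 := by
        rw [Finset.sum_congr rfl fun j _ => h1 j, ← Complex.ofReal_sum, ← Finset.mul_sum, h0]
        simp)
  refine LinearMap.ext fun x => (hsum x).trans (Finset.sum_eq_zero fun j _ => ?_)
  have hj : c j = 0 := hzero (Sum.inl j)
  have hAj : A j = 0 := congrArg Complex.re hj
  have hBj : B j = 0 := neg_eq_zero.1 (congrArg Complex.im hj)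
  rw [hAj, hBj, mul_zero, mul_zero, add_zero]

/-- The star image of `ℤ[ζ_n]` is dense. -/
lemma IsStarFamily.exists_starMap_mem (hn : 3 ≤ n) (hσ : IsStarFamily n σ)
    {V : Set (Fin (Nat.totient n / 2 - 1) → ℂ)} (hV : IsOpen V) (hne : V.Nonempty) :
    ∃ z ∈ cycIntegers n, starMap σ z ∈ V := by
  classical
  obtain ⟨x, hx⟩ := hne
  obtain ⟨ε, hε, hball⟩ := Metric.isOpen_iff.1 hV x hx
  obtain ⟨l, hl, hl0, hl1⟩ := hσ.exists_contracting hn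
  -- A real basis taken from the star image spans a lattice inside it, with covering radius at most
  -- `∑ ‖b i‖`. Multiplication by `l ^ N` shrinks this bound below `ε` in each coordinate.
  let b := Module.Basis.ofSpan (hσ.span_starMap hn)
  have : Fintype ((linearIndepOn_empty ℝ id).extend (Set.empty_subset
    (starMap σ '' (cycIntegers n : Set (cycField n))))) := FiniteDimensional.fintypeBasisIndex b
  have hspan : ∀ y ∈ Submodule.span ℤ (Set.range b), ∃ z ∈ cycIntegers n, starMap σ z = y := by
    intro y hy
    have h1 : Submodule.span ℤ (Set.range b) ≤ AddSubgroup.toIntSubmodule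
        ((Subalgebra.toSubmodule (cycIntegers n)).toAddSubgroup.map (starHom σ)) :=
      Submodule.span_le.2 fun s hs => Module.Basis.ofSpan_subset (hσ.span_starMap hn) hs
    exact h1 hy
  set C := ∑ i, ‖b i‖
  have hev : ∀ᶠ N : ℕ in Filter.atTop, ∀ j, ‖starMap σ l j‖ ^ N * C < ε := by
    rw [Filter.eventually_all]
    intro j
    have := (tendsto_pow_atTop_nhds_zero_of_lt_one (norm_nonneg _) (hl1 j)).mul_const C
    rw [zero_mul] at this
    exact this.eventually_lt_const hε
  obtain ⟨N, hN⟩ := hev.exists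
  have hlj : ∀ j, starMap σ l j ≠ 0 := fun j h => hl0 (by
    have : σ j l = 0 := Subtype.ext h
    simpa using this)
  set y : Fin (Nat.totient n / 2 - 1) → ℂ := fun j => x j / starMap σ l j ^ N with hy
  obtain ⟨z, hz, hzy⟩ := hspan _ (ZSpan.floor b y).2
  have hfract := ZSpan.norm_fract_le b y
  rw [ZSpan.fract_apply, ← hzy] at hfract
  refine ⟨l ^ N * z, mul_mem (pow_mem hl N) hz, hball ?_⟩
  rw [Metric.mem_ball', dist_eq_norm, pi_norm_lt_iff hε]
  intro j
  have h1 : (x - starMap σ (l ^ N * z)) j = starMap σ l j ^ N * (y - starMap σ z) j := by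
    rw [starMap_mul, starMap_pow]
    have := pow_ne_zero N (hlj j)
    simp only [Pi.sub_apply, Pi.mul_apply, Pi.pow_apply, hy]
    field_simp
  rw [h1, norm_mul, norm_pow]
  exact (mul_le_mul_of_nonneg_left ((norm_le_pi_norm _ j).trans hfract) (by positivity)).trans_lt
    (hN j)

/-- A cyclotomic model set contains a homothetic copy of each finite set of cyclotomic integers. -/
lemma IsCyclotomicModelSet.exists_homothety {Λ : Set ℂ} (hΛ : IsCyclotomicModelSet n Λ)
    {F : Set ℂ} (hF : F.Finite) (hFn : F ⊆ cycRing n) :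
    ∃ a b : ℂ, a ≠ 0 ∧ ∀ z ∈ F, b + a * z ∈ Λ := by
  obtain ⟨hn, σ, W, t, hσ, hW, -, rfl⟩ := hΛ
  obtain ⟨z₀, hz₀, hzW⟩ := hσ.exists_starMap_mem hn isOpen_interior hW
  obtain ⟨l, hl, hl0, hl1⟩ := hσ.exists_contracting hn
  -- Since `l` contracts under the star map, the star images of `z₀ + l ^ N * w` tend to that of
  -- `z₀`, an interior point of the window; finiteness of `F` gives a common `N`.
  have hev : ∀ z ∈ F, ∀ᶠ N : ℕ in Filter.atTop,
      ∀ w : cycField n, (w : ℂ) = z → starMap σ (z₀ + l ^ N * w) ∈ W := by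
    intro z hz
    have hlim : Filter.Tendsto (fun N : ℕ => starMap σ (z₀ + l ^ N *
        ⟨z, mem_cycField_of_mem_cycRing (hFn hz)⟩)) Filter.atTop (nhds (starMap σ z₀)) := by
      rw [tendsto_pi_nhds]
      intro j
      have h1 := (tendsto_pow_atTop_nhds_zero_of_norm_lt_one (hl1 j)).mul_const
        (starMap σ ⟨z, mem_cycField_of_mem_cycRing (hFn hz)⟩ j)
      rw [zero_mul] at h1
      have h2 := h1.const_add (starMap σ z₀ j)
      rw [add_zero] at h2
      refine h2.congr fun N => ?_
      simp [starMap]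
    filter_upwards [hlim.eventually (isOpen_interior.mem_nhds hzW)] with N hN w hw
    obtain rfl : w = ⟨z, mem_cycField_of_mem_cycRing (hFn hz)⟩ := Subtype.ext hw
    exact interior_subset hN
  obtain ⟨N, hN⟩ := ((Filter.eventually_all_finite hF).2 hev).exists
  refine ⟨(l : ℂ) ^ N, t + z₀, pow_ne_zero _ (by simpa using hl0), fun z hz => ?_⟩
  refine ⟨z₀ + l ^ N * ⟨z, mem_cycField_of_mem_cycRing (hFn hz)⟩, ?_, hN z hz _ rfl, ?_⟩
  · exact add_mem hz₀ (mul_mem (pow_mem hl N) (hFn hz))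
  · push_cast; ring

/-- Differences of points of a cyclotomic model set lie in the cyclotomic field. -/
lemma IsCyclotomicModelSet.sub_mem {Λ : Set ℂ} (hΛ : IsCyclotomicModelSet n Λ) {x y : ℂ}
    (hx : x ∈ Λ) (hy : y ∈ Λ) : x - y ∈ cycField n := by
  obtain ⟨hn, σ, W, t, hσ, hW, -, rfl⟩ := hΛ
  obtain ⟨z, -, -, rfl⟩ := hx
  obtain ⟨w, -, -, rfl⟩ := hy
  rw [add_sub_add_left_eq_sub]
  exact _root_.sub_mem z.2 w.2

end StarFamily

/-! ### Polygons inscribed in circles -/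

/-- The point of the unit circle with a given argument. -/
noncomputable def unitPoint (x : ℝ) : ℂ := ⟨Real.cos x, Real.sin x⟩

lemma unitPoint_eq_exp (x : ℝ) : unitPoint x = Complex.exp (x * Complex.I) :=
  Complex.ext (Complex.exp_ofReal_mul_I_re x).symm (Complex.exp_ofReal_mul_I_im x).symm

lemma unitPoint_add (x y : ℝ) : unitPoint (x + y) = unitPoint x * unitPoint y := by
  simp only [unitPoint_eq_exp, ← Complex.exp_add]; push_cast; ring_nf

lemma unitPoint_add_int_mul_two_pi (x : ℝ) (j : ℤ) :
    unitPoint (x + j * (2 * Real.pi)) = unitPoint x := by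
  simp [unitPoint, Real.cos_add_int_mul_two_pi, Real.sin_add_int_mul_two_pi]

/-- The product form makes positivity evident for arguments increasing within one turn. -/
lemma cross_unitPoint_sub (a b c : ℝ) :
    cross (unitPoint b - unitPoint a) (unitPoint c - unitPoint a)
      = 4 * Real.sin ((b - a) / 2) * Real.sin ((c - b) / 2) * Real.sin ((c - a) / 2) := by
  have h : cross (unitPoint b - unitPoint a) (unitPoint c - unitPoint a)
      = Real.sin (c - b) + Real.sin (b - a) - Real.sin (c - a) := by
    simp only [cross, unitPoint, Complex.sub_re, Complex.sub_im, Real.sin_sub]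
    ring
  rw [h]
  obtain ⟨x, rfl⟩ : ∃ x, b = a + 2 * x := ⟨(b - a) / 2, by ring⟩
  obtain ⟨y, rfl⟩ : ∃ y, c = a + 2 * x + 2 * y := ⟨(c - a - 2 * x) / 2, by ring⟩
  rw [show a + 2 * x + 2 * y - (a + 2 * x) = 2 * y by ring, show a + 2 * x - a = 2 * x by ring,
    show a + 2 * x + 2 * y - a = 2 * (x + y) by ring, mul_div_cancel_left₀ _ two_ne_zero,
    mul_div_cancel_left₀ _ two_ne_zero, mul_div_cancel_left₀ _ two_ne_zero]
  simp only [Real.sin_add, Real.cos_add, Real.sin_two_mul]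
  linear_combination -2 * Real.sin x * Real.cos x * Real.sin_sq_add_cos_sq y
    - 2 * Real.sin y * Real.cos y * Real.sin_sq_add_cos_sq x

/-- A chord of the unit circle is orthogonal to the direction of its midpoint. -/
lemma cross_I_mul_unitPoint_sub {x a b : ℝ} (h : a + b = 2 * x) :
    cross (Complex.I * unitPoint x) (unitPoint b - unitPoint a) = 0 := by
  obtain rfl : b = 2 * x - a := by linarith
  obtain ⟨y, rfl⟩ : ∃ y, a = x + y := ⟨a - x, by ring⟩
  rw [show 2 * x - (x + y) = x - y by ring]
  simp [cross, unitPoint, Real.cos_add, Real.cos_sub, Real.sin_add, Real.sin_sub]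
  ring

lemma cross_I_mul_unitPoint (x y : ℝ) :
    cross (Complex.I * unitPoint x) (Complex.I * unitPoint y) = Real.sin (y - x) := by
  simp [cross, unitPoint, Real.sin_sub]
  ring

lemma exists_zmod_lift {α : Type*} {m : ℕ} [NeZero m] {f : ℤ → α} (hf : ∀ i, f (i + m) = f i) :
    ∃ v : ZMod m → α, ∀ a : ℤ, v a = f a := by
  refine ⟨fun i => f i.val, fun a => ?_⟩
  have hp : Function.Periodic f (m : ℤ) := hf
  have := hp.sub_zsmul_eq (x := a) (a / m)
  rw [← this]
  change f _ = _
  rw [ZMod.val_intCast]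
  congr 1
  rw [smul_eq_mul, Int.emod_def]; ring

lemma exists_circle_eq_mul {z : ℂ} (hz : z ≠ 0) :
    ∃ (u : Circle) (s : ℝ), s ≠ 0 ∧ (u : ℂ) = (s : ℂ) * z := by
  refine ⟨⟨((‖z‖⁻¹ : ℝ) : ℂ) * z, ?_⟩, ‖z‖⁻¹, inv_ne_zero (norm_ne_zero_iff.2 hz), rfl⟩
  change _ ∈ Metric.sphere (0 : ℂ) 1
  rw [mem_sphere_zero_iff_norm, norm_mul, Complex.norm_real, norm_inv, norm_norm,
    inv_mul_cancel₀ (norm_ne_zero_iff.2 hz)]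

/-- The arguments of the vertices of a polygon with dihedral symmetry. -/
noncomputable def dihedralArg (k : ℕ) (ε : ℝ) (i : ℤ) : ℝ :=
  Real.pi / k * (i - 1 / 2) + if Even i then ε else -ε

/-- The gaps between consecutive arguments alternate between `π / k + 2 * ε` and `π / k - 2 * ε`. -/
lemma dihedralArg_lt_succ {k : ℕ} (hk : k ≠ 0) {ε : ℝ} (hε : |ε| < Real.pi / (2 * k)) (i : ℤ) :
    dihedralArg k ε i < dihedralArg k ε (i + 1) := by
  have hk' : (0 : ℝ) < k := by exact_mod_cast Nat.pos_of_ne_zero hk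
  obtain ⟨h1, h2⟩ := abs_lt.1 hε
  have h3 : Real.pi / k = 2 * (Real.pi / (2 * k)) := by field_simp
  simp only [dihedralArg, Int.even_add_one]
  push_cast
  split_ifs <;> linarith

lemma dihedralArg_add {k : ℕ} (ε : ℝ) (i j : ℤ) :
    dihedralArg k ε (i + 2 * j) = dihedralArg k ε i + 2 * Real.pi / k * j := by
  have : Even (i + 2 * j) ↔ Even i := by simp [Int.even_add]
  simp only [dihedralArg, this]
  push_cast; ring

/-- The reflection reverses parity, so the two offsets `±ε` cancel: the two vertices are mirror
images in the line of argument `π l / k`. -/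
lemma dihedralArg_reflect {k : ℕ} (ε : ℝ) (i l : ℤ) :
    dihedralArg k ε i + dihedralArg k ε (2 * l + 1 - i) = 2 * (Real.pi / k * l) := by
  have : Even (2 * l + 1 - i) ↔ ¬ Even i := by
    have h1 : ¬ Even (2 * l + 1) := Int.not_even_iff_odd.2 ⟨l, rfl⟩
    rw [Int.even_sub]
    tauto
  simp only [dihedralArg, this]
  push_cast
  split_ifs <;> ring

/-- The affine image of a polygon with dihedral symmetry is a `U`-polygon all of whose edges have
directions in `U`. -/
lemma existsUPolygonOfClassGeFour_of_dihedral {k : ℕ} (hk : 4 ≤ k) {ε r d : ℝ}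
    (hε : |ε| < Real.pi / (2 * k)) (hr : r ≠ 0) (hd : 0 < d) {M : ℂ →ₗ[ℝ] ℂ}
    (hM : ∀ a b, cross (M a) (M b) = d * cross a b) {c : ℂ} {Λ : Set ℂ}
    (hΛ : ∀ i : ℤ, c + M ((r : ℂ) * unitPoint (dihedralArg k ε i)) ∈ Λ) :
    ExistsUPolygonOfClassGeFour Λ (2 * k) := by
  classical
  have hk0 : k ≠ 0 := by omega
  have : NeZero (2 * k) := ⟨by omega⟩
  set θ := dihedralArg k ε
  have hmono : StrictMono θ := strictMono_int_of_lt_succ (dihedralArg_lt_succ hk0 hε)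
  have hθ : ∀ i : ℤ, θ (i + (2 * k : ℕ)) = θ i + (1 : ℤ) * (2 * Real.pi) := by
    intro i
    push_cast
    simp only [θ, dihedralArg_add]
    have : (k : ℝ) ≠ 0 := by exact_mod_cast hk0
    push_cast
    field_simp
  obtain ⟨v, hv⟩ := exists_zmod_lift (m := 2 * k)
    (f := fun i : ℤ => c + M ((r : ℂ) * unitPoint (θ i))) (fun i => by
      simp only [hθ, unitPoint_add_int_mul_two_pi])
  have hMr : ∀ z, M ((r : ℂ) * z) = (r : ℂ) * M z := fun z => by
    rw [← Complex.real_smul, map_smul, Complex.real_smul]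
  have hsub : ∀ a b : ℤ, v b - v a = (r : ℂ) * M (unitPoint (θ b) - unitPoint (θ a)) := by
    intro a b
    rw [hv, hv, hMr, hMr, map_sub]; ring
  have hconv : IsConvexPolygon (2 * k) v := by
    refine isConvexPolygon_of_cross_pos (by omega) fun a b c hab hbc hca => ?_
    rw [hsub, hsub, cross_ofReal_mul_left, cross_ofReal_mul_right, hM, cross_unitPoint_sub]
    have h1 := hmono hab
    have h2 := hmono hbc
    have h3 := hmono hca
    rw [hθ] at h3
    push_cast at h3
    have s1 := Real.sin_pos_of_pos_of_lt_pi (x := (θ b - θ a) / 2) (by linarith) (by linarith)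
    have s2 := Real.sin_pos_of_pos_of_lt_pi (x := (θ c - θ b) / 2) (by linarith) (by linarith)
    have s3 := Real.sin_pos_of_pos_of_lt_pi (x := (θ c - θ a) / 2) (by linarith) (by linarith)
    have : 0 < r * r := mul_self_pos.2 hr
    rw [← mul_assoc]
    positivity
  have hMinj : ∀ z, M z = 0 → z = 0 := by
    intro z hz
    have h1 := hM z (Complex.I * z)
    rw [hz] at h1
    have h2 : cross z (Complex.I * z) = z.re * z.re + z.im * z.im := by simp [cross]
    have h3 : cross 0 (M (Complex.I * z)) = 0 := by simp [cross]
    rw [h2, h3, zero_eq_mul, or_iff_right hd.ne'] at h1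
    obtain ⟨h4, h5⟩ := (mul_self_add_mul_self_eq_zero).1 h1
    exact Complex.ext h4 h5
  have hI : ∀ x, Complex.I * unitPoint x ≠ 0 := fun x => by
    rw [unitPoint_eq_exp]
    exact mul_ne_zero Complex.I_ne_zero (Complex.exp_ne_zero _)
  -- The directions are the images under `M` of the normals to the `k` mirrors.
  choose u s hs0 hus using fun l : ℕ => exists_circle_eq_mul
    (fun h => hI (Real.pi / k * l) (hMinj _ h))
  have hcross : ∀ l l' : ℕ, l < l' → l' < k → cross (u l : ℂ) (u l') ≠ 0 := by
    intro l l' h1 h2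
    rw [hus, hus, cross_ofReal_mul_left, cross_ofReal_mul_right, hM, cross_I_mul_unitPoint]
    have hk' : (0 : ℝ) < k := by exact_mod_cast Nat.pos_of_ne_zero hk0
    have h1' : (l : ℝ) < l' := by exact_mod_cast h1
    have h2' : (l' : ℝ) < k := by exact_mod_cast h2
    have hl0 : (0 : ℝ) ≤ l := Nat.cast_nonneg l
    have hsin : 0 < Real.sin (Real.pi / k * l' - Real.pi / k * l) := by
      rw [← mul_sub]
      apply Real.sin_pos_of_pos_of_lt_pi
      · have := sub_pos.2 h1'; positivity
      · rw [div_mul_eq_mul_div, div_lt_iff₀ hk']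
        exact mul_lt_mul_of_pos_left (by linarith) Real.pi_pos
    exact mul_ne_zero (hs0 _) (mul_ne_zero (hs0 _) (mul_pos hd hsin).ne')
  have hcross' : ∀ l l' : ℕ, l < k → l' < k → l ≠ l' → cross (u l : ℂ) (u l') ≠ 0 := by
    intro l l' h1 h2 h3
    rcases lt_or_gt_of_ne h3 with h | h
    · exact hcross l l' h h2
    · rw [cross_comm]; exact neg_ne_zero.2 (hcross l' l h h1)
  have hinj : Set.InjOn u (Finset.range k) := by
    intro l hl l' hl' h
    by_contra hne
    exact hcross' l l' (by simpa using hl) (by simpa using hl') hne (by rw [h, cross_self])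
  have hpair : ∀ (l : ℕ) (a : ℤ), ∃ t : ℝ, v (2 * l + 1 - a : ℤ) - v a = (t : ℂ) * (u l : ℂ) := by
    intro l a
    have h := cross_I_mul_unitPoint_sub (dihedralArg_reflect (k := k) ε a l)
    obtain ⟨t, ht⟩ := exists_eq_ofReal_mul_of_cross_eq_zero (hI _) h
    refine ⟨r * t * (s l)⁻¹, ?_⟩
    have hsl : (s l : ℂ) ≠ 0 := by exact_mod_cast hs0 l
    rw [hsub, ht, hus, ← Complex.real_smul (x := t), map_smul, Complex.real_smul]
    push_cast
    field_simp
  have hcard : (Finset.image u (Finset.range k)).card = k := by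
    rw [Finset.card_image_of_injOn hinj, Finset.card_range]
  refine ⟨Finset.image u (Finset.range k), k, v, hk, ⟨⟨hconv, ?_, ?_⟩, by omega, ?_, ?_⟩, ?_⟩
  · intro x hx y hy hxy
    obtain ⟨l, hl, rfl⟩ := Finset.mem_image.1 hx
    obtain ⟨l', hl', rfl⟩ := Finset.mem_image.1 hy
    exact hcross' l l' (by simpa using hl) (by simpa using hl') (fun h => hxy (congrArg u h))
  · intro i x hx
    obtain ⟨l, hl, rfl⟩ := Finset.mem_image.1 hx
    obtain ⟨a, rfl⟩ := ZMod.intCast_surjective i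
    obtain ⟨t, ht⟩ := hpair l a
    refine ⟨(2 * l + 1 - a : ℤ), fun h => ?_, t, by rw [← ht]; ring⟩
    rw [ZMod.intCast_eq_intCast_iff_dvd_sub] at h
    have := (Dvd.intro k (by push_cast; ring) : (2 : ℤ) ∣ (2 * k : ℕ)).trans h
    omega
  -- All `2 * k` edges have directions in `U`, so the class is the cap `card U = k`.
  · rw [hcard]
    refine ⟨le_rfl, by omega, 0, fun j hj => ?_⟩
    refine ⟨u j, Finset.mem_image_of_mem u (Finset.mem_range.2 hj), ?_⟩
    obtain ⟨t, ht⟩ := hpair j j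
    rw [show 2 * (j : ℤ) + 1 - j = j + 1 by ring] at ht
    push_cast at ht
    rw [zero_add, Parallel, ht, cross_ofReal_mul_right, cross_self, mul_zero]
  · intro x hx
    rw [← hcard]; exact hx.1
  · intro i
    obtain ⟨a, rfl⟩ := ZMod.intCast_surjective i
    rw [hv]
    exact hΛ a

/-! ### Polygons with vertices in cyclotomic model sets -/

lemma unitPoint_zpow_period {k : ℕ} (hk : k ≠ 0) (j : ℤ) :
    unitPoint (2 * Real.pi / k * j) ^ k = 1 := by
  have hk' : (k : ℂ) ≠ 0 := by exact_mod_cast hk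
  rw [unitPoint_eq_exp, ← Complex.exp_nat_mul, Complex.exp_eq_one_iff]
  refine ⟨j, ?_⟩
  push_cast
  field_simp

lemma zeta_eq_unitPoint (k : ℕ) : zeta k = unitPoint (2 * Real.pi / k) := by
  rw [zeta_eq, unitPoint_eq_exp]

/-- The point `2 + ζ_k` lies strictly between two neighbouring mirrors of the dihedral group. -/
lemma exists_polar_two_add_zeta {k : ℕ} (hk : 3 ≤ k) :
    ∃ r φ : ℝ, r ≠ 0 ∧ 0 < φ ∧ φ < Real.pi / k ∧ 2 + zeta k = (r : ℂ) * unitPoint φ := by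
  have hk' : (3 : ℝ) ≤ k := by exact_mod_cast hk
  have him : 0 < (2 + zeta k).im := by simpa using zeta_im_pos hk
  have h0 : 2 + zeta k ≠ 0 := fun h => by rw [h] at him; simp at him
  set φ := (2 + zeta k).arg
  set x := Real.pi / k with hx
  have hx0 : 0 < x := by positivity
  have hxpi : x < Real.pi := by
    rw [hx, div_lt_iff₀ (by linarith)]; nlinarith [Real.pi_pos]
  obtain ⟨N, hn, hpolar⟩ : ∃ N : ℝ, 0 < N ∧ 2 + zeta k = (N : ℂ) * unitPoint φ :=
    ⟨‖2 + zeta k‖, norm_pos_iff.2 h0, by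
      rw [unitPoint_eq_exp]; exact (Complex.norm_mul_exp_arg_mul_I _).symm⟩
  have hsin : 0 < Real.sin x := Real.sin_pos_of_pos_of_lt_pi hx0 hxpi
  have hφpi : φ ≤ Real.pi := Complex.arg_le_pi _
  have hφ0 : 0 < φ := by
    have h1 : 0 ≤ φ := Complex.arg_nonneg_iff.2 him.le
    refine lt_of_le_of_ne h1 fun h => ?_
    exact him.ne' (Complex.arg_eq_zero_iff.1 h.symm).2
  refine ⟨N, φ, hn.ne', hφ0, ?_, hpolar⟩
  by_contra hle
  -- Rotating `2 + ζ_k` by `-x` gives imaginary part `sin x - 2 * sin x < 0`, which excludes `φ ≥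
  -- x`.
  have h1 : 0 ≤ Real.sin (φ - x) := Real.sin_nonneg_of_nonneg_of_le_pi (by linarith) (by linarith)
  have hre := congrArg Complex.re hpolar
  have him' := congrArg Complex.im hpolar
  rw [Complex.re_ofReal_mul, zeta_eq_unitPoint] at hre
  rw [Complex.im_ofReal_mul, zeta_eq_unitPoint] at him'
  rw [show 2 * Real.pi / k = 2 * x by rw [hx]; ring] at hre him'
  simp only [unitPoint, Complex.add_re, Complex.add_im, Complex.re_ofNat, Complex.im_ofNat,
    Real.sin_two_mul, Real.cos_two_mul] at hre him'
  have h2 : N * Real.sin (φ - x) = -Real.sin x := by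
    rw [Real.sin_sub]
    linear_combination -Real.cos x * him' + Real.sin x * hre
  nlinarith [mul_nonneg hn.le h1]

lemma cross_mul_mul (a x y : ℂ) : cross (a * x) (a * y) = Complex.normSq a * cross x y := by
  simp only [cross, Complex.normSq_apply, Complex.mul_re, Complex.mul_im]; ring

/-- A linear image of the orbit of `2 + ζ_k` under the dihedral group gives a polygon in each
cyclotomic model set, if it consists of cyclotomic integers. -/
lemma existsUPolygonOfClassGeFour_of_linearMap {n k : ℕ} {Λ : Set ℂ}
    (hΛ : IsCyclotomicModelSet n Λ) (hk : 4 ≤ k) {L : ℂ →ₗ[ℝ] ℂ} {d : ℝ} (hd : 0 < d)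
    (hL : ∀ a b, cross (L a) (L b) = d * cross a b)
    (hmem : ∀ z : ℂ, z ^ k = 1 →
      L (z * (2 + zeta k)) ∈ cycRing n ∧ L (z * (2 + (zeta k)⁻¹)) ∈ cycRing n) :
    ExistsUPolygonOfClassGeFour Λ (2 * k) := by
  have hk0 : k ≠ 0 := by omega
  have hk' : (0 : ℝ) < k := by exact_mod_cast Nat.pos_of_ne_zero hk0
  set R : Set ℂ := {z | z ^ k = 1} with hR
  have hRfin : R.Finite := by
    refine (Polynomial.nthRootsFinset k (1 : ℂ)).finite_toSet.subset fun z hz => ?_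
    exact (Polynomial.mem_nthRootsFinset (Nat.pos_of_ne_zero hk0) _).2 hz
  obtain ⟨a, b, ha, hab⟩ := hΛ.exists_homothety
    (F := (fun z => L (z * (2 + zeta k))) '' R ∪ (fun z => L (z * (2 + (zeta k)⁻¹))) '' R)
    ((hRfin.image _).union (hRfin.image _)) (by
      rintro _ (⟨z, hz, rfl⟩ | ⟨z, hz, rfl⟩)
      · exact (hmem z hz).1
      · exact (hmem z hz).2)
  obtain ⟨r, φ, hr, hφ0, hφ1, hpolar⟩ := exists_polar_two_add_zeta (k := k) (by omega)
  have hpolar' : 2 + (zeta k)⁻¹ = (r : ℂ) * unitPoint (-φ) := by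
    have h1 : (zeta k)⁻¹ = (starRingEnd ℂ) (zeta k) := by
      rw [Complex.inv_eq_conj]
      rw [zeta_eq, Complex.norm_exp_ofReal_mul_I]
    have h2 : unitPoint (-φ) = (starRingEnd ℂ) (unitPoint φ) := by
      apply Complex.ext <;> simp [unitPoint]
    rw [h1, h2]
    have := congrArg (starRingEnd ℂ) hpolar
    rwa [map_mul, map_add, Complex.conj_ofReal, Complex.conj_ofNat] at this
  have hhalf : Real.pi / k = 2 * (Real.pi / (2 * k)) := by field_simp
  -- With this `ε` the arguments are `2πj/k - φ` at index `2j` and `2πj/k + φ` at `2j + 1`; the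
  -- bound on `ε` says `0 < φ < π / k`.
  refine existsUPolygonOfClassGeFour_of_dihedral (ε := Real.pi / (2 * k) - φ) (r := r)
    (d := Complex.normSq a * d) (M := (LinearMap.mulLeft ℝ a).comp L) (c := b) hk ?_ hr
    (mul_pos (Complex.normSq_pos.2 ha) hd) (fun x y => ?_) (fun i => ?_)
  · rw [abs_lt]
    constructor <;> linarith
  · rw [LinearMap.comp_apply, LinearMap.comp_apply, LinearMap.mulLeft_apply,
      LinearMap.mulLeft_apply, cross_mul_mul, hL, mul_assoc]
  · apply hab
    rcases Int.even_or_odd' i with ⟨j, rfl | rfl⟩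
    · right
      refine ⟨_, unitPoint_zpow_period hk0 j, ?_⟩
      simp only [dihedralArg, even_two_mul, if_true]
      rw [hpolar', mul_left_comm, ← unitPoint_add]
      congr 3
      push_cast
      rw [hhalf]; ring
    · left
      refine ⟨_, unitPoint_zpow_period hk0 j, ?_⟩
      have hodd : ¬ Even (2 * j + 1) := Int.not_even_iff_odd.2 ⟨j, rfl⟩
      simp only [dihedralArg, hodd, if_false]
      rw [hpolar, mul_left_comm, ← unitPoint_add]
      congr 3
      push_cast
      rw [hhalf]; ring

/-- Polygons with the symmetry of a root of unity in `ℤ[ζ_n]`. -/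
lemma existsUPolygonOfClassGeFour_of_roots_mem {n k : ℕ} {Λ : Set ℂ}
    (hΛ : IsCyclotomicModelSet n Λ) (hk : 4 ≤ k) (h : ∀ z : ℂ, z ^ k = 1 → z ∈ cycRing n) :
    ExistsUPolygonOfClassGeFour Λ (2 * k) := by
  have hα : zeta k ^ k = 1 := (isPrimitiveRoot_zeta (by omega)).pow_eq_one
  have h2 : (2 : ℂ) ∈ cycRing n := ofNat_mem _ 2
  exact existsUPolygonOfClassGeFour_of_linearMap hΛ hk (L := LinearMap.id) one_pos
    (fun a b => by simp) fun z hz =>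
      ⟨mul_mem (h z hz) (add_mem h2 (h _ hα)),
        mul_mem (h z hz) (add_mem h2 (h _ (by rw [inv_pow, hα, inv_one])))⟩

lemma mem_cycRing_of_pow_eq_one {n : ℕ} (hn : n ≠ 0) {z : ℂ} (hz : z ^ n = 1) : z ∈ cycRing n := by
  have : NeZero n := ⟨hn⟩
  obtain ⟨i, -, rfl⟩ := (isPrimitiveRoot_zeta hn).eq_pow_of_pow_eq_one hz
  exact pow_mem (zeta_mem_cycRing n) i

lemma mem_cycRing_of_pow_two_mul_eq_one {n : ℕ} (hn : Odd n) {z : ℂ} (hz : z ^ (2 * n) = 1) :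
    z ∈ cycRing n := by
  have hn0 : n ≠ 0 := by rintro rfl; simp at hn
  rw [two_mul, pow_add, mul_self_eq_one_iff] at hz
  rcases hz with hz | hz
  · exact mem_cycRing_of_pow_eq_one hn0 hz
  · rw [← neg_neg z]
    exact neg_mem (mem_cycRing_of_pow_eq_one hn0 (by rw [hn.neg_pow, hz, neg_neg]))

/-- Polygons with the symmetry of a root of unity of degree two exist in all cyclotomic model
sets. -/
lemma existsUPolygonOfClassGeFour_of_quadratic {n k : ℕ} {Λ : Set ℂ}
    (hΛ : IsCyclotomicModelSet n Λ) (hk : 4 ≤ k) {p q : ℤ}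
    (hquad : zeta k ^ 2 = p + q * zeta k) : ExistsUPolygonOfClassGeFour Λ (2 * k) := by
  have hn : 3 ≤ n := hΛ.1
  have : NeZero k := ⟨by omega⟩
  have hα := isPrimitiveRoot_zeta (n := k) (by omega)
  have himk := zeta_im_pos (n := k) (by omega)
  have himn := zeta_im_pos hn
  set α := zeta k with hαdef
  -- The real-linear map fixing 1 and sending `α` to `ζ_n`. It carries `S = ℤ + ℤα`, a ring by
  -- `hquad`, into `ℤ[ζ_n]`, and preserves orientation since both imaginary parts are positive.
  let L : ℂ →ₗ[ℝ] ℂ :=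
    Complex.reLm.smulRight (1 : ℂ) + Complex.imLm.smulRight (((α.im⁻¹ : ℝ) : ℂ) * (zeta n - α.re))
  have hLapply : ∀ z, L z = z.re + z.im * ((α.im⁻¹ : ℝ) * (zeta n - α.re)) := fun z => by
    simp [L]
  set S : Set ℂ := {z | ∃ x y : ℤ, z = x + y * α} with hS
  have hmul : ∀ z ∈ S, ∀ w ∈ S, z * w ∈ S := by
    rintro _ ⟨x, y, rfl⟩ _ ⟨x', y', rfl⟩
    refine ⟨x * x' + y * y' * p, x * y' + y * x' + y * y' * q, ?_⟩
    push_cast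
    linear_combination (y * y' : ℂ) * hquad
  have hpow : ∀ i : ℕ, α ^ i ∈ S := by
    intro i
    induction i with
    | zero => exact ⟨1, 0, by simp⟩
    | succ i ih => rw [pow_succ]; exact hmul _ ih _ ⟨0, 1, by simp⟩
  have hroot : ∀ z : ℂ, z ^ k = 1 → z ∈ S := by
    intro z hz
    obtain ⟨i, -, rfl⟩ := hα.eq_pow_of_pow_eq_one hz
    exact hpow i
  have htwo : ∀ z ∈ S, 2 + z ∈ S := by
    rintro _ ⟨x, y, rfl⟩
    exact ⟨2 + x, y, by push_cast; ring⟩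
  have hLS : ∀ z ∈ S, L z ∈ cycRing n := by
    rintro _ ⟨x, y, rfl⟩
    have : L (x + y * α) = x + y * zeta n := by
      rw [hLapply]
      have : (α.im : ℂ) ≠ 0 := by exact_mod_cast himk.ne'
      simp only [Complex.add_re, Complex.add_im, Complex.intCast_re, Complex.intCast_im,
        Complex.mul_re, Complex.mul_im]
      push_cast
      field_simp
      ring
    rw [this]
    exact add_mem (intCast_mem _ x) (mul_mem (intCast_mem _ y) (zeta_mem_cycRing n))
  refine existsUPolygonOfClassGeFour_of_linearMap hΛ hk (L := L) (d := (zeta n).im / α.im)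
    (by positivity) (fun a b => ?_) fun z hz =>
      ⟨hLS _ (hmul _ (hroot z hz) _ (htwo _ (hroot _ hα.pow_eq_one))),
        hLS _ (hmul _ (hroot z hz) _ (htwo _ (hroot _ (by rw [inv_pow, hα.pow_eq_one, inv_one]))))⟩
  rw [hLapply, hLapply]
  simp only [cross, Complex.add_re, Complex.add_im, Complex.ofReal_re, Complex.ofReal_im,
    Complex.mul_re, Complex.mul_im, Complex.sub_re, Complex.sub_im]
  field_simp
  ring

lemma zeta_four_sq : zeta 4 ^ 2 = ((-1 : ℤ) : ℂ) + ((0 : ℤ) : ℂ) * zeta 4 := by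
  have h := isPrimitiveRoot_zeta (n := 4) (by norm_num)
  have h1 : (zeta 4 ^ 2 - 1) * (zeta 4 ^ 2 + 1) = 0 := by linear_combination h.pow_eq_one
  have h2 := (mul_eq_zero.1 h1).resolve_left
    (sub_ne_zero.2 (h.pow_ne_one_of_pos_of_lt (by norm_num) (by norm_num)))
  push_cast
  linear_combination h2

lemma zeta_six_sq : zeta 6 ^ 2 = ((-1 : ℤ) : ℂ) + ((1 : ℤ) : ℂ) * zeta 6 := by
  have h := isPrimitiveRoot_zeta (n := 6) (by norm_num)
  have h1 : (zeta 6 ^ 3 - 1) * ((zeta 6 + 1) * (zeta 6 ^ 2 - zeta 6 + 1)) = 0 := by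
    linear_combination h.pow_eq_one
  have h2 := (mul_eq_zero.1 h1).resolve_left
    (sub_ne_zero.2 (h.pow_ne_one_of_pos_of_lt (by norm_num) (by norm_num)))
  have h3 := (mul_eq_zero.1 h2).resolve_left (fun h3 =>
    h.pow_ne_one_of_pos_of_lt (l := 2) (by norm_num) (by norm_num)
      (by linear_combination (zeta 6 - 1) * h3))
  push_cast
  linear_combination h3

lemma existsUPolygonOfClassGeFour_eight {n : ℕ} {Λ : Set ℂ} (hΛ : IsCyclotomicModelSet n Λ) :
    ExistsUPolygonOfClassGeFour Λ 8 :=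
  existsUPolygonOfClassGeFour_of_quadratic hΛ le_rfl zeta_four_sq

lemma existsUPolygonOfClassGeFour_twelve {n : ℕ} {Λ : Set ℂ} (hΛ : IsCyclotomicModelSet n Λ) :
    ExistsUPolygonOfClassGeFour Λ 12 :=
  existsUPolygonOfClassGeFour_of_quadratic hΛ (by norm_num) zeta_six_sq

lemma existsUPolygonOfClassGeFour_two_mul {n : ℕ} {Λ : Set ℂ} (hΛ : IsCyclotomicModelSet n Λ)
    (hn : 4 ≤ n) : ExistsUPolygonOfClassGeFour Λ (2 * n) :=
  existsUPolygonOfClassGeFour_of_roots_mem hΛ hn fun _ => mem_cycRing_of_pow_eq_one (by omega)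

lemma existsUPolygonOfClassGeFour_four_mul {n : ℕ} {Λ : Set ℂ} (hΛ : IsCyclotomicModelSet n Λ)
    (hn : Odd n) : ExistsUPolygonOfClassGeFour Λ (4 * n) := by
  have := hΛ.1
  rw [show 4 * n = 2 * (2 * n) by ring]
  exact existsUPolygonOfClassGeFour_of_roots_mem hΛ (by omega) fun _ =>
    mem_cycRing_of_pow_two_mul_eq_one hn

/-- The numbers of edges of `U`-polygons of class at least four in cyclotomic model sets. -/
lemma edges_of_existsUPolygonOfClassGeFour {n k : ℕ} {Λ : Set ℂ} (hΛ : IsCyclotomicModelSet n Λ)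
    (hk : 4 ≤ k) (h : ExistsUPolygonOfClassGeFour Λ (2 * k)) :
    k = 4 ∨ k = 6 ∨ k ∣ n ∨ ∃ g, Odd g ∧ g ∣ n ∧ k = 2 * g := by
  obtain ⟨U, c, v, hc, ⟨hP, -, ⟨-, hcm, i, hi⟩, -⟩, hv⟩ := h
  obtain ⟨a, ha, haK⟩ := hP.exists_isPrimitiveRoot rfl hk
    ⟨by omega, i, fun j hj => hi j (by omega)⟩ (cycField n) (fun i j => hΛ.sub_mem (hv i) (hv j))
  have hn := hΛ.1
  exact order_of_trace_mem_cycField (by omega) hk ha haK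

end UPoly

theorem corollary4p2 (m n : ℕ) (hm : 8 ≤ m) (hm2 : Even m) (hn : 3 ≤ n) (Λ : Set ℂ)
    (hΛ : UPoly.IsCyclotomicModelSet n Λ) :
    (n ∈ ({3, 4} : Set ℕ) →
      (UPoly.ExistsUPolygonOfClassGeFour Λ m ↔ m ∈ ({8, 12} : Set ℕ))) ∧
    (n ∈ ({8, 9, 12} : Set ℕ) ∪ {k : ℕ | ∃ p : ℕ, UPoly.IsSophieGermain p ∧ k = 2 * p + 1} →
      ((n = 8 ∨ n = 12) →
        (UPoly.ExistsUPolygonOfClassGeFour Λ m ↔ m ∈ ({8, 12, 2 * n} : Set ℕ))) ∧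
      (¬ (n = 8 ∨ n = 12) →
        (UPoly.ExistsUPolygonOfClassGeFour Λ m ↔ m ∈ ({8, 12, 2 * n, 4 * n} : Set ℕ)))) := by
  obtain ⟨k, rfl⟩ := hm2.exists_two_nsmul
  rw [smul_eq_mul] at *
  have hk : 4 ≤ k := by omega
  have h8 := UPoly.existsUPolygonOfClassGeFour_eight hΛ
  have h12 := UPoly.existsUPolygonOfClassGeFour_twelve hΛ
  have hnec := UPoly.edges_of_existsUPolygonOfClassGeFour (k := k) hΛ hk
  simp only [Set.mem_union, Set.mem_insert_iff, Set.mem_singleton_iff, Set.mem_ofPred_eq]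
  refine ⟨fun h34 => ⟨fun h => ?_, ?_⟩, fun hcase => ⟨fun h812 => ⟨fun h => ?_, ?_⟩,
    fun h812 => ⟨fun h => ?_, ?_⟩⟩⟩
  · rcases hnec h with h | h | h | ⟨g, ⟨l, rfl⟩, hg, rfl⟩
    · omega
    · omega
    · have := Nat.le_of_dvd (by omega) h; omega
    · have := Nat.le_of_dvd (by omega) hg
      omega
  · rintro (h | h) <;> rw [h] <;> assumption
  · rcases hnec h with h | h | h | ⟨g, ⟨l, rfl⟩, hg, rfl⟩
    · omega
    · omega
    · have := Nat.le_of_dvd (by omega) h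
      rcases h812 with rfl | rfl <;> interval_cases k <;> omega
    · have := Nat.le_of_dvd (by omega) hg
      have : l ≤ 5 := by omega
      rcases h812 with rfl | rfl <;> interval_cases l <;> omega
  · rintro (h | h | h)
    · rwa [h]
    · rwa [h]
    · rw [h]
      exact UPoly.existsUPolygonOfClassGeFour_two_mul hΛ (by omega)
  -- Here `n` is 9 or a prime, so with `k ≥ 4` the divisor conditions leave only `n`, `2 * n` and 6.
  · have hdvd : ∀ d, d ∣ n → d = 1 ∨ d = 3 ∨ d = n := by
      intro d hd
      rcases hcase with (rfl | rfl | rfl) | ⟨p, ⟨-, hp⟩, rfl⟩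
      · omega
      · have := Nat.le_of_dvd (by omega) hd
        interval_cases d <;> omega
      · omega
      · rcases (Nat.dvd_prime hp).1 hd with h | h
        · exact Or.inl h
        · exact Or.inr (Or.inr h)
    rcases hnec h with h | h | h | ⟨g, -, hg, rfl⟩
    · omega
    · omega
    · have := hdvd k h; omega
    · have := hdvd g hg; omega
  · have hodd : Odd n := by
      rcases hcase with (rfl | rfl | rfl) | ⟨p, -, rfl⟩
      · omega
      · decide
      · omega
      · exact ⟨p, rfl⟩
    have hn4 : 4 ≤ n := by
      rcases hcase with (rfl | rfl | rfl) | ⟨p, ⟨hp, -⟩, rfl⟩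
      · omega
      · omega
      · omega
      · have := hp.two_le; omega
    rintro (h | h | h | h)
    · rwa [h]
    · rwa [h]
    · rw [h]
      exact UPoly.existsUPolygonOfClassGeFour_two_mul hΛ hn4
    · rw [h]
      exact UPoly.existsUPolygonOfClassGeFour_four_mul hΛ hodd
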